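/- Setting. Consider $K\ge 1$ agents, a finite state set $\mathcal S$, finite action sets $\mathcal A_k$ and observation sets $\mathcal O_k$, a transition model $\mathbb T(s\mid s',a)$ (the probability of moving from $s'$ to $s$ under the joint action $a=(a_1,\dots,a_K)$), likelihoods $L_k(\xi\mid s)$ (densities with respect to a $\sigma$-finite reference measure on $\mathcal O_k$) and policies $\pi_k(\cdot\mid\mu)$ depending on a belief $\mu$, i.e. a probability vector on $\mathcal S$. Write $\pi_k(\cdot\mid s)$ for $\pi_k(\cdot\mid\delta_s)$. The agents are the vertices of a connected graph, with a symmetric, doubly stochastic matrix $C=[c_{\ell k}]$ of weights $c_{\ell k}\ge 0$ such that, for $\ell\ne k$, $c_{\ell k}>0$ iff $\ell$ and $k$ are adjacent, and $c_{kk}>0$ for some $k$. Let $\mathcal N_{k^n}$ be the set of agents at hop distance at most $n$ from $k$, $\mathcal N_k=\mathcal N_{k^1}$ (so $k\in\mathcal N_k$), $d_{\min}=\min_k|\mathcal N_k|$, $\lambda_2$ the second largest modulus of an eigenvalue of $C$ ($0$ if $K=1$), $\beta>0$ and $\lambda=\max\{|1-K/\beta|,\lambda_2\}$. For a set $H$ of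 agents, averaging out the actions of the agents outside $H$ gives $$\mathbb T^\pi_H(s\mid s',a_H)=\sum_{a_{H^c}}\mathbb T(s\mid s',a_H,a_{H^c})\prod_{\ell\notin H}\pi_\ell(a_\ell\mid s')$$ (if $\prod_{\ell\in H}\pi_\ell(a_\ell\mid s')>0$, this is $\sum_{a_{H^c}}\mathbb T(s\mid s',a)\prod_{\ell=1}^K\pi_\ell(a_\ell\mid s')$ normalized over $s$). Beliefs. The centralized beliefs start from a prior $\eta_0>0$ on $\mathcal S$ and satisfy $\mu_i(s)\propto\eta_i(s)\prod_k L_k(\xi_{k,i}\mid s)$ and $\eta_{i+1}(s)=\sum_{s'}\mathbb T(s\mid s',a_i)\mu_i(s')$. The local beliefs start from priors $\eta_{k,0}>0$ and satisfy $$\psi_{k,i}(s)\propto L_k(\xi_{k,i}\mid s)^\beta\,\eta_{k,i}(s),\qquad \mu_{k,i}(s)\propto\prod_{\ell\in\mathcal N_k}\psi_{\ell,i}(s)^{c_{\ell k}},\qquad \eta_{k,i+1}(s)=\sum_{s'}\mathbb T^\pi_{\mathcal N_k}(s\mid s',a_{\mathcal N_k,i})\,\mu_{k,i}(s').$$ The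 process evolves as follows: $s_0\sim\eta_0$; given all the past, $\xi_{1,i},\dots,\xi_{K,i}$ are independent with densities $L_k(\cdot\mid s_i)$, then the actions $a_{k,i}\sim\pi_k(\cdot\mid\mu_{k,i})$ are drawn independently, then $s_{i+1}\sim\mathbb T(\cdot\mid s_i,a_i)$. Assumptions. (i) For all $k,s,s'$, $D_{\mathrm{KL}}(L_k(\cdot\mid s)\,\|\,L_k(\cdot\mid s'))<\infty$, and $|\log L_k(\xi\mid s)|\le B$ on the support of $L_k(\cdot\mid s)$. (ii) There is a constant $\kappa(\mathbb T)<1$ such that for every joint action $a$ the Dobrushin coefficient $\max_{s',s''}\frac12\sum_s|\mathbb T(s\mid s',a)-\mathbb T(s\mid s'',a)|$ is at most $\kappa(\mathbb T)$. (iii) For all $k$, $n\ge1$, $s'$ and $a$, $\mathbb T^\pi_{\mathcal N_{k^n}}(\cdot\mid s',a)$ and $\mathbb T^\pi_{\mathcal N_{k^{n+1}}}(\cdot\mid s',a)$ have the same support, on which the logarithm of their ratio is at most $\tau$ in absolute value. Theorem. Almost surely $\mu_i(s)=\mathbb P(s_i=s\mid \xi_0,\dots,\xi_i,a_0,\dots,a_{i-1})$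 and $\eta_i(s)=\mathbb P(s_i=s\mid \xi_0,\dots,\xi_{i-1},a_0,\dots,a_{i-1})$. Let $J_{k,i}=\mathbb E\,D_{\mathrm{KL}}(\mu_i\,\|\,\mu_{k,i})$ and $\widetilde J_{k,i}=\mathbb E\,D_{\mathrm{KL}}(\eta_i\,\|\,\eta_{k,i})$. Then for every agent $k$ $$\limsup_{i\to\infty}J_{k,i}\le b:=\frac{2\sqrt K\,\beta\lambda B+(K-d_{\min})\tau}{1-\kappa(\mathbb T)},\qquad \limsup_{i\to\infty}\widetilde J_{k,i}\le \tilde b:=\frac{2\kappa(\mathbb T)\sqrt K\,\beta\lambda B+(K-d_{\min})\tau}{1-\kappa(\mathbb T)},$$ and the bounds are reached at the linear rate $\kappa(\mathbb T)$: there is a finite constant $c\ge0$ with $J_{k,i}\le b+c\,\kappa(\mathbb T)^i$ and $\widetilde J_{k,i}\le\tilde b+c\,\kappa(\mathbb T)^i$ for all $k$ and $i$. -/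

import Mathlib

open MeasureTheory ProbabilityTheory Filter InformationTheory
open scoped ENNReal NNReal Topology

noncomputable section

/-- A decentralized POMDP with `K` agents, state set `S`, action sets `A k` and observation
sets `O k` (rewards and discount factor play no role for beliefs and are omitted).
`trans s s' a` is the probability `𝕋(s | s', a)` of moving from `s'` to `s` under the joint
action `a`; `lik k ξ s` is the marginal likelihood `L_k(ξ | s)`, a density with respect to
the reference measure `ref k` (counting measure for discrete observations, Lebesgue measure
for continuous ones, ...). -/
structure DecPOMDP (K : ℕ) (S : Type*) (A O : Fin K → Type*) [Fintype S]
    [∀ k, MeasurableSpace (O k)] where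
  trans : S → S → (∀ k, A k) → ℝ
  trans_nonneg : ∀ s s' a, 0 ≤ trans s s' a
  trans_sum : ∀ s' a, ∑ s, trans s s' a = 1
  ref : ∀ k, Measure (O k)
  ref_sigmaFinite : ∀ k, SigmaFinite (ref k)
  lik : ∀ k, O k → S → ℝ
  lik_nonneg : ∀ k ξ s, 0 ≤ lik k ξ s
  lik_measurable : ∀ k s, Measurable fun ξ => lik k ξ s
  lik_mass : ∀ k s, ∫⁻ ξ, ENNReal.ofReal (lik k ξ s) ∂(ref k) = 1

/-- The policies `π_k(a | μ)` of the agents: `prob k μ a` is the probability that agent `k`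
takes action `a` when its belief is `μ`. Only the values at beliefs `μ` in the probability
simplex are meaningful. -/
structure JointPolicy (K : ℕ) (S : Type*) (A : Fin K → Type*) [Fintype S]
    [∀ k, Fintype (A k)] where
  prob : ∀ k, (S → ℝ) → A k → ℝ
  prob_nonneg : ∀ k, ∀ μ ∈ stdSimplex ℝ S, ∀ a, 0 ≤ prob k μ a
  prob_sum : ∀ k, ∀ μ ∈ stdSimplex ℝ S, ∑ a, prob k μ a = 1
  prob_measurable : ∀ k a, Measurable fun μ => prob k μ a

/-- The communication network: an undirected (strongly) connected graph whose edges are the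
pairs with positive combination weight `c_{ℓk} = weight ℓ k`; the combination matrix is
symmetric and doubly stochastic, and at least one agent has a positive self-weight. -/
structure Network (K : ℕ) where
  graph : SimpleGraph (Fin K)
  weight : Matrix (Fin K) (Fin K) ℝ
  weight_nonneg : ∀ l k, 0 ≤ weight l k
  weight_symm : weight.IsSymm
  weight_sum : ∀ k, ∑ l, weight l k = 1
  adj_iff : ∀ l k, l ≠ k → (graph.Adj l k ↔ 0 < weight l k)
  connected : graph.Connected
  self_weight : ∃ k, 0 < weight k k

namespace Network

variable {K : ℕ} (N : Network K)

open Classical in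
/-- The agents at hop distance at most `n` from `k` (the graph is connected, so that
`SimpleGraph.dist` is the true hop distance). In particular `k` itself belongs to the set. -/
def hop (k : Fin K) (n : ℕ) : Finset (Fin K) :=
  Finset.univ.filter fun l => N.graph.dist k l ≤ n

/-- The neighbourhood `𝒩_k`; it contains `k`. -/
def nbhd (k : Fin K) : Finset (Fin K) := N.hop k 1

/-- The minimum degree `d_min = min_k |𝒩_k|`. -/
def minDeg : ℕ := ⨅ k, (N.nbhd k).card

/-- The mixing rate `λ₂`, the second largest modulus of an eigenvalue of the combination
matrix. Since the combination matrix is primitive, its largest eigenvalue `1` is simple, and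
`λ₂` is the largest modulus of the other eigenvalues (all real by symmetry); it is `0` if
`K = 1`. -/
def mixingRate : ℝ :=
  sSup {r | ∃ x : ℝ, Module.End.HasEigenvalue (Matrix.toLin' N.weight) x ∧ x ≠ 1 ∧ r = |x|}

/-- `λ = max {|1 - K/β|, λ₂}`. -/
def lam (β : ℝ) : ℝ := max |1 - (K : ℝ) / β| N.mixingRate

end Network

/-- `f` rescaled to total mass one: the meaning of `∝`. -/
def rescale {S : Type*} [Fintype S] (f : S → ℝ) : S → ℝ := fun s => f s / ∑ s', f s'

/-- A vector with nonnegative entries seen as a measure on its index set. -/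
def vecMeasure {S : Type*} [Fintype S] [MeasurableSpace S] (p : S → ℝ) : Measure S :=
  ∑ s, ENNReal.ofReal (p s) • Measure.dirac s

/-- Kullback-Leibler divergence `D_KL(p ‖ q)` of two beliefs, with values in `[0, ∞]`. -/
def beliefKL {S : Type*} [Fintype S] [MeasurableSpace S] (p q : S → ℝ) : ℝ≥0∞ :=
  klDiv (vecMeasure p) (vecMeasure q)

open Classical in
/-- The belief that gives mass one to the state `s`. -/
def pointBelief {S : Type*} (s : S) : S → ℝ := Pi.single s 1

section Beliefs

variable {K : ℕ} {S : Type*} {A O : Fin K → Type*} [Fintype S] [∀ k, Fintype (A k)]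
  [∀ k, MeasurableSpace (O k)]

namespace DecPOMDP

variable (M : DecPOMDP K S A O)

/-- The distribution `L_k(· | s)` of the observation of agent `k` in state `s`. -/
def obsLaw (k : Fin K) (s : S) : Measure (O k) :=
  (M.ref k).withDensity fun ξ => ENNReal.ofReal (M.lik k ξ s)

/-- The distribution of the joint observation in state `s` (spatial independence). -/
def jointObsLaw (s : S) : Measure (∀ k, O k) := Measure.pi fun k => M.obsLaw k s

/-- The joint likelihood `L(ξ | s) = ∏_k L_k(ξ_k | s)`. -/
def jointLik (ξ : ∀ k, O k) (s : S) : ℝ := ∏ k, M.lik k (ξ k) s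

/-- The Dobrushin coefficient `κ(𝕋^a)` of the transition matrix of the joint action `a`. -/
def dobrushin (a : ∀ k, A k) : ℝ :=
  ⨆ p : S × S, (1 / 2 : ℝ) * ∑ s, |M.trans s p.1 a - M.trans s p.2 a|

open Classical in
/-- The transition model in which the actions of the agents outside `H` are averaged out,
where in state `s'` an agent `l` outside `H` is taken to choose its action according to
`π_l(· | s')`. Only the components of `a` in `H` matter. Whenever the normalization makes
sense, this is the normalized sum over the unknown actions of
`𝕋(s | s', a) ∏_l π_l(a_l | s')`, see `localTrans_eq_rescale`. -/
def localTrans (π : JointPolicy K S A) (H : Finset (Fin K)) (s s' : S) (a : ∀ k, A k) : ℝ :=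
  ∑ a' ∈ Finset.univ.filter (fun a' : ∀ k, A k => ∀ l ∈ H, a' l = a l),
    M.trans s s' a' * ∏ l ∈ Hᶜ, π.prob l (pointBelief s') (a' l)

open Classical in
/-- `localTrans` is the sum over the unknown actions of
`𝕋(s | s', a) ∏_l π_l(a_l | s')`, normalized over `s`, whenever the known actions have positive
probability in state `s'`. -/
theorem localTrans_eq_rescale (π : JointPolicy K S A) (H : Finset (Fin K)) (s s' : S)
    (a : ∀ k, A k) (ha : ∀ l ∈ H, 0 < π.prob l (pointBelief s') (a l)) :
    M.localTrans π H s s' a = rescale (fun t =>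
      ∑ a' ∈ Finset.univ.filter (fun a' : ∀ k, A k => ∀ l ∈ H, a' l = a l),
        M.trans t s' a' * ∏ l, π.prob l (pointBelief s') (a' l)) s := by
  set c : ℝ := ∏ l ∈ H, π.prob l (pointBelief s') (a l) with hc
  have hcpos : 0 < c := Finset.prod_pos ha
  have key : ∀ t, (∑ a' ∈ Finset.univ.filter (fun a' : ∀ k, A k => ∀ l ∈ H, a' l = a l),
      M.trans t s' a' * ∏ l, π.prob l (pointBelief s') (a' l))
        = c * M.localTrans π H t s' a := by
    intro t
    rw [localTrans, Finset.mul_sum]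
    refine Finset.sum_congr rfl fun a' ha' => ?_
    rw [← Finset.prod_mul_prod_compl H]
    have : ∏ l ∈ H, π.prob l (pointBelief s') (a' l) = c :=
      Finset.prod_congr rfl fun l hl => by rw [(Finset.mem_filter.mp ha').2 l hl]
    rw [this]; ring
  have hsimp : pointBelief s' ∈ stdSimplex ℝ S := by
    unfold pointBelief
    exact single_mem_stdSimplex ℝ s'
  have hsum : ∑ t, M.localTrans π H t s' a = 1 := by
    simp only [localTrans]
    rw [Finset.sum_comm]
    simp_rw [← Finset.sum_mul, M.trans_sum, one_mul]
    have h1 : (Finset.univ.filter fun a' : ∀ k, A k => ∀ l ∈ H, a' l = a l)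
        = Fintype.piFinset fun l => if l ∈ H then {a l} else Finset.univ := by
      ext a'
      simp only [Finset.mem_filter, Finset.mem_univ, true_and, Fintype.mem_piFinset]
      refine forall_congr' fun l => ?_
      by_cases hl : l ∈ H <;> simp [hl]
    have h2 : ∀ a' : ∀ k, A k, ∏ l ∈ Hᶜ, π.prob l (pointBelief s') (a' l)
        = ∏ l, if l ∈ H then 1 else π.prob l (pointBelief s') (a' l) := by
      intro a'
      rw [← Finset.prod_mul_prod_compl H]
      rw [Finset.prod_eq_one (s := H) (fun l hl => by simp [hl]), one_mul]
      exact Finset.prod_congr rfl fun l hl => by simp [Finset.mem_compl.mp hl]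
    simp_rw [h2]
    rw [h1, ← Finset.prod_univ_sum (fun l => if l ∈ H then {a l} else Finset.univ)
      (fun l (b : A l) => if l ∈ H then (1 : ℝ) else π.prob l (pointBelief s') b)]
    refine Finset.prod_eq_one fun l _ => ?_
    by_cases hl : l ∈ H
    · simp [hl]
    · simp [hl, π.prob_sum l _ hsimp]
  simp only [rescale, key, ← Finset.mul_sum, hsum, mul_one]
  field_simp

/-- The `β`-scaled local Bayesian update: the intermediate beliefs `ψ_k`, from the joint
observation `ξ` and the local priors `η`. -/
def adapt (β : ℝ) (ξ : ∀ k, O k) (η : Fin K → S → ℝ) (k : Fin K) : S → ℝ :=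
  rescale fun s => M.lik k (ξ k) s ^ β * η k s

/-- Geometric averaging over the neighbours. -/
def combine (N : Network K) (ψ : Fin K → S → ℝ) (k : Fin K) : S → ℝ :=
  rescale fun s => ∏ l ∈ N.nbhd k, ψ l s ^ N.weight l k

/-- The priors `η_{k,i}` of the diffusion recursion with initial priors `ηloc`, along the
joint observations `x 0, x 1, …` and the joint actions `u 0, u 1, …`. -/
def localPrior (π : JointPolicy K S A) (N : Network K) (β : ℝ) (ηloc : Fin K → S → ℝ)
    (x : ℕ → ∀ k, O k) (u : ℕ → ∀ k, A k) : ℕ → Fin K → S → ℝ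
  | 0 => ηloc
  | i + 1 => fun k s => ∑ s', M.localTrans π (N.nbhd k) s s' (u i) *
      combine N (M.adapt β (x i) (localPrior π N β ηloc x u i)) k s'

/-- The local beliefs `μ_{k,i}` of the diffusion recursion. -/
def localBelief (π : JointPolicy K S A) (N : Network K) (β : ℝ) (ηloc : Fin K → S → ℝ)
    (x : ℕ → ∀ k, O k) (u : ℕ → ∀ k, A k) (i : ℕ) : Fin K → S → ℝ :=
  combine N (M.adapt β (x i) (M.localPrior π N β ηloc x u i))

/-- The centralized priors `η_i`, with initial prior `ηcen`. -/
def centralPrior (ηcen : S → ℝ) (x : ℕ → ∀ k, O k) (u : ℕ → ∀ k, A k) : ℕ → S → ℝ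
  | 0 => ηcen
  | i + 1 => fun s => ∑ s', M.trans s s' (u i) *
      rescale (fun t => M.jointLik (x i) t * centralPrior ηcen x u i t) s'

/-- The centralized beliefs `μ_i`. -/
def centralBelief (ηcen : S → ℝ) (x : ℕ → ∀ k, O k) (u : ℕ → ∀ k, A k) (i : ℕ) : S → ℝ :=
  rescale fun t => M.jointLik (x i) t * M.centralPrior ηcen x u i t

/-- The likelihoods carry bounded information: the divergences between the likelihoods of any
two states are finite, and `|log L_k(ξ | s)| ≤ B` over the support. -/
structure BoundedLik (B : ℝ) : Prop where
  kl_finite : ∀ k s s', klDiv (M.obsLaw k s) (M.obsLaw k s') ≠ ∞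
  log_le : ∀ k s, ∀ᵐ ξ ∂(M.ref k), M.lik k ξ s ≠ 0 → |Real.log (M.lik k ξ s)| ≤ B

/-- For `n ≥ 1`, the transition models that use the actions of the agents within `n` hops and
within `n + 1` hops have the same support, on which their log-ratio is bounded by `τ`. -/
structure HopBound (π : JointPolicy K S A) (N : Network K) (τ : ℝ) : Prop where
  supp : ∀ k n, 1 ≤ n → ∀ s s' a,
    (M.localTrans π (N.hop k n) s s' a = 0 ↔ M.localTrans π (N.hop k (n + 1)) s s' a = 0)
  log_le : ∀ k n, 1 ≤ n → ∀ s s' a, M.localTrans π (N.hop k n) s s' a ≠ 0 →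
    |Real.log (M.localTrans π (N.hop k n) s s' a /
      M.localTrans π (N.hop k (n + 1)) s s' a)| ≤ τ

end DecPOMDP

end Beliefs

/-- The `σ`-algebra generated by `X 0, …, X (n - 1)`. -/
abbrev sigmaBefore {Ω E : Type*} [MeasurableSpace E] (X : ℕ → Ω → E) (n : ℕ) :
    MeasurableSpace Ω :=
  ⨆ j, ⨆ _ : j < n, MeasurableSpace.comap (X j) inferInstance

/-- The states `s`, observations `ξ` and actions `a` on `(Ω, P)` evolve as in the Dec-POMDP
when every agent runs the diffusion recursion and acts on its local belief: `s 0 ∼ ηcen`,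
and, given everything that happened before,
* the observations at time `i` are distributed according to the likelihoods at `s i`,
* the agents choose their actions independently with `a_{k,i} ∼ π_k(· | μ_{k,i})`,
* the next state is drawn from `𝕋(· | s i, a i)`. -/
structure IsDiffusionProcess {K : ℕ} {S : Type*} {A O : Fin K → Type*} [Fintype S]
    [MeasurableSpace S] [∀ k, Fintype (A k)] [∀ k, MeasurableSpace (A k)]
    [∀ k, MeasurableSpace (O k)] {Ω : Type*} [MeasurableSpace Ω]
    (M : DecPOMDP K S A O) (π : JointPolicy K S A) (N : Network K) (β : ℝ)
    (ηcen : S → ℝ) (ηloc : Fin K → S → ℝ) (P : Measure Ω)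
    (s : ℕ → Ω → S) (ξ : ℕ → Ω → ∀ k, O k) (a : ℕ → Ω → ∀ k, A k) : Prop where
  measurable_state : ∀ i, Measurable (s i)
  measurable_obs : ∀ i, Measurable (ξ i)
  measurable_act : ∀ i, Measurable (a i)
  init : ∀ x, P.real {ω | s 0 ω = x} = ηcen x
  obs : ∀ i, ∀ E : Set (∀ k, O k), MeasurableSet E →
    P⟦ξ i ⁻¹' E | sigmaBefore s (i + 1) ⊔ sigmaBefore ξ i ⊔ sigmaBefore a i⟧
      =ᵐ[P] fun ω => (M.jointObsLaw (s i ω)).real E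
  act : ∀ i, ∀ u : ∀ k, A k,
    P⟦a i ⁻¹' {u} | sigmaBefore s (i + 1) ⊔ sigmaBefore ξ (i + 1) ⊔ sigmaBefore a i⟧
      =ᵐ[P] fun ω => ∏ k, π.prob k
        (M.localBelief π N β ηloc (fun j => ξ j ω) (fun j => a j ω) i k) (u k)
  step : ∀ i, ∀ x : S,
    P⟦s (i + 1) ⁻¹' {x} |
        sigmaBefore s (i + 1) ⊔ sigmaBefore ξ (i + 1) ⊔ sigmaBefore a (i + 1)⟧
      =ᵐ[P] fun ω => M.trans x (s i ω) (a i ω)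

section Risks

variable {K : ℕ} {S : Type*} {A O : Fin K → Type*} [Fintype S] [MeasurableSpace S]
  [∀ k, Fintype (A k)] [∀ k, MeasurableSpace (O k)] {Ω : Type*} [MeasurableSpace Ω]

/-- The risk `J_{k,i}`: expected divergence of the centralized belief `μ_i` from the local
belief `μ_{k,i}`. -/
def postRisk (M : DecPOMDP K S A O) (π : JointPolicy K S A) (N : Network K) (β : ℝ)
    (ηcen : S → ℝ) (ηloc : Fin K → S → ℝ) (P : Measure Ω)
    (ξ : ℕ → Ω → ∀ k, O k) (a : ℕ → Ω → ∀ k, A k) (k : Fin K) (i : ℕ) : ℝ≥0∞ :=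
  ∫⁻ ω, beliefKL (M.centralBelief ηcen (fun j => ξ j ω) (fun j => a j ω) i)
    (M.localBelief π N β ηloc (fun j => ξ j ω) (fun j => a j ω) i k) ∂P

/-- The prior risk: expected divergence of the centralized prior `η_i` from the local
prior `η_{k,i}`. -/
def priorRisk (M : DecPOMDP K S A O) (π : JointPolicy K S A) (N : Network K) (β : ℝ)
    (ηcen : S → ℝ) (ηloc : Fin K → S → ℝ) (P : Measure Ω)
    (ξ : ℕ → Ω → ∀ k, O k) (a : ℕ → Ω → ∀ k, A k) (k : Fin K) (i : ℕ) : ℝ≥0∞ :=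
  ∫⁻ ω, beliefKL (M.centralPrior ηcen (fun j => ξ j ω) (fun j => a j ω) i)
    (M.localPrior π N β ηloc (fun j => ξ j ω) (fun j => a j ω) i k) ∂P

end Risks

end

/-! Write R = √K β λ B and Y = (K − d_min) τ, and denote by J and J̃ the risks after and before the
observation. Two one-step inequalities carry the theorem: J_{k,i} ≤ Σ_l c_{lk} J̃_{l,i} + 2R
(`postRisk_le`) and J̃_{k,i+1} ≤ κ J_{k,i} + Y (`priorRisk_succ_le`). The weights of a column sum to
one, so a bound common to all agents passes through the first inequality. The affine map x ↦ κ (x +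
2R) + Y contracts at rate κ to its fixed point b̃, and b = b̃ + 2R (`risk_le`).

Observation step. With m the predictive density of the observation and Z the normalizer of the
unnormalized product ∏_l (L_l^β η_l)^{c_{lk}}, one has log(μ/μ_k) = Σ_l c_{lk} log(η/η_l) + Σ_l (1 −
β c_{lk}) log L_l + log(Z/m). The middle sum is at most B Σ_l |1 − β c_{lk}| ≤ R, by spectral
contraction of C and Cauchy–Schwarz (`sum_abs_one_sub_weight_le`). Replacing the exponents β c_{lk}
by 1 inside Z costs another R and leaves Z' = Σ_s L z, where z is the geometric mean of the local
priors. Now log(Z'/m) ≤ Z'/m − 1, and integration against m turns this into Σ z − 1 ≤ 0, by the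
inequality of arithmetic and geometric means. The bound is thus one in expectation, not along paths.

Prediction step. This one is pathwise. The kernel 𝕋 contracts the divergence by its Dobrushin
coefficient (`klSum_kernel_le`): the divergence is a mixture of hinge functionals Σ (p/γ − q)⁺ and Σ
(q − p/γ)⁺, each of which contracts by a transport argument. Replacing 𝕋 by the local kernel in the
second argument costs at most Y, because the neighbourhood grows to the whole network by adding at
most K − d_min agents (`trans_le`).

The observation step needs the predictive law of ξ_i to be the mixture of the likelihoods with
weights η_i, that is, η_i must be the true conditional law of the state. This is an induction
(`condProb_prior`) with Bayes' rule for the observation and the remark that actions depend on the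
state only through the joint information, so that they do not alter the posterior. Throughout, local
and central beliefs keep equal supports (`SameSupport`), which makes all divergences finite even
when transitions have zeros. -/

set_option linter.unusedSectionVars false

/-! ### Spectral estimates for the combination matrix, and hop neighbourhoods. -/

namespace Network

variable {K : ℕ} (N : Network K)

theorem weight_comm (l k : Fin K) : N.weight l k = N.weight k l :=
  N.weight_symm.apply k l

theorem sum_weight_row (k : Fin K) : ∑ l, N.weight k l = 1 := by
  rw [← N.weight_sum k]
  exact Finset.sum_congr rfl fun l _ => N.weight_comm k l

/-- The Dirichlet form of the combination matrix. -/
theorem sum_weight_mul_sub_sq (x : Fin K → ℝ) :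
    ∑ l, ∑ k, N.weight l k * (x l - x k) ^ 2
      = 2 * (∑ l, x l ^ 2 - ∑ l, x l * (N.weight.mulVec x) l) := by
  have h1 : ∑ l, ∑ k, N.weight l k * x l ^ 2 = ∑ l, x l ^ 2 := by
    refine Finset.sum_congr rfl fun l _ => ?_
    rw [← Finset.sum_mul, N.sum_weight_row, one_mul]
  have h2 : ∑ l, ∑ k, N.weight l k * x k ^ 2 = ∑ l, x l ^ 2 := by
    rw [Finset.sum_comm]
    refine Finset.sum_congr rfl fun l _ => ?_
    rw [← Finset.sum_mul, N.weight_sum, one_mul]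
  have h3 : ∑ l, ∑ k, N.weight l k * (x l * x k) = ∑ l, x l * (N.weight.mulVec x) l := by
    refine Finset.sum_congr rfl fun l _ => ?_
    simp only [Matrix.mulVec, dotProduct, Finset.mul_sum]
    exact Finset.sum_congr rfl fun k _ => by ring
  have h4 : ∀ l k, N.weight l k * (x l - x k) ^ 2 = N.weight l k * x l ^ 2
      + N.weight l k * x k ^ 2 - 2 * (N.weight l k * (x l * x k)) := fun l k => by ring
  simp only [h4, Finset.sum_sub_distrib, Finset.sum_add_distrib, ← Finset.mul_sum, h1, h2, h3]
  ring

/-- The eigenvectors of the combination matrix for the eigenvalue one are constant. -/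
theorem eq_of_mulVec_eq_self {x : Fin K → ℝ} (hx : N.weight.mulVec x = x) (l k : Fin K) :
    x l = x k := by
  have h0 : ∑ l, ∑ k, N.weight l k * (x l - x k) ^ 2 = 0 := by
    rw [N.sum_weight_mul_sub_sq, hx]
    simp [sq]
  have hnn : ∀ l k, 0 ≤ N.weight l k * (x l - x k) ^ 2 := fun l k =>
    mul_nonneg (N.weight_nonneg l k) (sq_nonneg _)
  have hadj : ∀ l k, N.graph.Adj l k → x l = x k := by
    intro l k h
    have h1 := (Finset.sum_eq_zero_iff_of_nonneg
      (fun l _ => Finset.sum_nonneg fun k _ => hnn l k)).1 h0 l (Finset.mem_univ _)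
    have h2 := (Finset.sum_eq_zero_iff_of_nonneg (fun k _ => hnn l k)).1 h1 k (Finset.mem_univ _)
    have h3 := (N.adj_iff l k h.ne).1 h
    have h4 := (mul_eq_zero.1 h2).resolve_left h3.ne'
    exact sub_eq_zero.1 (pow_eq_zero_iff two_ne_zero |>.1 h4)
  obtain ⟨w⟩ := N.connected.preconnected l k
  induction w with
  | nil => rfl
  | cons h _ ih => exact (hadj _ _ h).trans ih

theorem abs_le_mixingRate {x : ℝ} (hx : Module.End.HasEigenvalue (Matrix.toLin' N.weight) x)
    (hx1 : x ≠ 1) : |x| ≤ N.mixingRate := by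
  refine le_csSup ?_ ⟨x, hx, hx1, rfl⟩
  refine (((Module.End.finite_hasEigenvalue (Matrix.toLin' N.weight)).image
    (fun x : ℝ => |x|)).subset ?_).bddAbove
  rintro r ⟨y, hy, -, rfl⟩
  exact ⟨y, hy, rfl⟩

theorem mixingRate_nonneg : 0 ≤ N.mixingRate :=
  Real.sSup_nonneg fun _ ⟨_, _, _, h⟩ => h ▸ abs_nonneg _

/-- The combination matrix contracts mean-zero vectors by the mixing rate. -/
theorem sum_mulVec_sq_le {v : Fin K → ℝ} (hv : ∑ l, v l = 0) :
    ∑ l, (N.weight.mulVec v) l ^ 2 ≤ N.mixingRate ^ 2 * ∑ l, v l ^ 2 := by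
  have hA : N.weight.IsHermitian := by
    rw [Matrix.IsHermitian, Matrix.conjTranspose_eq_transpose_of_trivial]
    exact N.weight_symm
  set b := hA.eigenvectorBasis
  have hpars : ∀ w : Fin K → ℝ, ∑ l, w l ^ 2 = ∑ j, ((b j).ofLp ⬝ᵥ w) ^ 2 := by
    intro w
    have h := b.sum_sq_norm_inner_right (WithLp.toLp 2 w)
    rw [EuclideanSpace.norm_sq_eq] at h
    simp only [Real.norm_eq_abs, sq_abs] at h
    rw [← h]
    refine Finset.sum_congr rfl fun j _ => ?_
    rw [EuclideanSpace.inner_eq_star_dotProduct]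
    simp [dotProduct_comm]
  have hb : ∀ j, N.weight.mulVec (b j).ofLp = hA.eigenvalues j • (b j).ofLp :=
    fun j => hA.mulVec_eigenvectorBasis j
  rw [hpars, hpars v, Finset.mul_sum]
  refine Finset.sum_le_sum fun j _ => ?_
  have h1 : (b j).ofLp ⬝ᵥ N.weight.mulVec v = hA.eigenvalues j * ((b j).ofLp ⬝ᵥ v) := by
    rw [Matrix.dotProduct_mulVec, ← Matrix.mulVec_transpose, N.weight_symm, hb, smul_dotProduct,
      smul_eq_mul]
  rw [h1, mul_pow]
  by_cases he : hA.eigenvalues j = 1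
  -- Eigenvectors for the eigenvalue one are constant, hence orthogonal to `v`; only the eigenvalues
  -- counted by `mixingRate` remain.
  · have hc := N.eq_of_mulVec_eq_self (x := (b j).ofLp) (by rw [hb, he, one_smul])
    have : (b j).ofLp ⬝ᵥ v = 0 := by
      obtain ⟨k⟩ : Nonempty (Fin K) := ⟨j⟩
      simp only [dotProduct]
      rw [Finset.sum_congr rfl fun l _ => by rw [hc l k], ← Finset.mul_sum, hv, mul_zero]
    simp [this]
  · refine mul_le_mul_of_nonneg_right ?_ (sq_nonneg _)
    refine sq_le_sq' ?_ ?_ <;> have := N.abs_le_mixingRate (x := hA.eigenvalues j) (by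
      refine Module.End.hasEigenvalue_of_hasEigenvector (x := (b j).ofLp) ⟨?_, ?_⟩
      · rw [Module.End.mem_eigenspace_iff, Matrix.toLin'_apply, hb]
      · intro h0
        have := b.orthonormal.1 j
        rw [show b j = 0 from by ext l; exact congrFun h0 l] at this
        simp at this) he
    · exact (abs_le.1 this).1
    · exact (abs_le.1 this).2

/-- The deviation of the scaled combination weights of an agent from one. -/
theorem sum_abs_one_sub_weight_le {β : ℝ} (hβ : 0 < β) (k : Fin K) :
    ∑ l, |1 - β * N.weight l k| ≤ √(K : ℝ) * β * N.lam β := by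
  have hK : (0 : ℝ) < K := by exact_mod_cast k.pos
  have hlam0 : 0 ≤ N.lam β := le_max_of_le_right N.mixingRate_nonneg
  -- The unit vector of `k` minus the uniform vector; the matrix maps it to column `k` minus the
  -- uniform vector.
  set v : Fin K → ℝ := fun l => (Pi.single k 1 : Fin K → ℝ) l - 1 / K with hvdef
  have hv : ∑ l, v l = 0 := by
    simp [hvdef, Finset.sum_sub_distrib, hK.ne']
  have hvsq : ∑ l, v l ^ 2 = 1 - 1 / K := by
    have : ∀ l, v l ^ 2 = (Pi.single k 1 : Fin K → ℝ) l * (1 - 2 / K) + (1 / K) ^ 2 := by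
      intro l
      by_cases h : l = k
      · subst h; simp [hvdef]; ring
      · simp [hvdef, h]
    simp only [this, Finset.sum_add_distrib, ← Finset.sum_mul]
    simp
    field_simp
    ring
  have hCv : ∀ l, N.weight.mulVec v l = N.weight l k - 1 / K := by
    intro l
    simp only [Matrix.mulVec, dotProduct, hvdef, mul_sub, Finset.sum_sub_distrib, ← Finset.sum_mul,
      N.sum_weight_row]
    simp [Pi.single_apply]
  have hsum0 : ∑ l, (N.weight l k - 1 / K) = 0 := by
    simp [Finset.sum_sub_distrib, N.weight_sum, hK.ne']
  have hmix : ∑ l, (N.weight l k - 1 / K) ^ 2 ≤ N.mixingRate ^ 2 * (1 - 1 / K) := by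
    have := N.sum_mulVec_sq_le hv
    simpa only [hCv, hvsq] using this
  have hsq : ∑ l, (1 - β * N.weight l k) ^ 2 ≤ β ^ 2 * N.lam β ^ 2 := by
    -- Square of β c − 1 = β ((1 − K/β)/K + (c − 1/K)). The cross term disappears after summation
    -- over `l`, since the column sums to one.
    have h1 : ∀ l, (1 - β * N.weight l k) ^ 2 = β ^ 2 * ((1 - K / β) ^ 2 * (1 / K ^ 2)
        + 2 * ((1 - K / β) / K) * (N.weight l k - 1 / K) + (N.weight l k - 1 / K) ^ 2) := by
      intro l
      field_simp
      ring
    have ha : (1 - K / β) ^ 2 ≤ N.lam β ^ 2 := sq_le_sq' (by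
      have := (abs_le.1 (le_max_left |1 - (K : ℝ) / β| N.mixingRate)).1
      exact this) ((le_abs_self _).trans (le_max_left _ _))
    have hm : N.mixingRate ^ 2 ≤ N.lam β ^ 2 :=
      pow_le_pow_left₀ N.mixingRate_nonneg (le_max_right _ _) 2
    have hK1 : (0 : ℝ) ≤ 1 - 1 / K := by
      rw [← hvsq]; exact Finset.sum_nonneg fun l _ => sq_nonneg _
    simp only [h1, ← Finset.mul_sum, Finset.sum_add_distrib, hsum0]
    refine mul_le_mul_of_nonneg_left ?_ (sq_nonneg β)
    simp only [Finset.sum_const, Finset.card_univ, Fintype.card_fin, nsmul_eq_mul, mul_zero,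
      add_zero]
    calc (1 - K / β) ^ 2 * ((K : ℝ) * (1 / K ^ 2)) + ∑ l, (N.weight l k - 1 / K) ^ 2
        ≤ (1 - K / β) ^ 2 * (1 / K) + N.mixingRate ^ 2 * (1 - 1 / K) := by
          refine add_le_add (le_of_eq ?_) hmix
          field_simp
      -- A convex combination with weights 1/K and 1 − 1/K, which is why the maximum of the two
      -- rates suffices.
      _ ≤ N.lam β ^ 2 * (1 / K) + N.lam β ^ 2 * (1 - 1 / K) := by gcongr
      _ = N.lam β ^ 2 := by ring
  have hcs : (∑ l, |1 - β * N.weight l k|) ^ 2 ≤ K * (β ^ 2 * N.lam β ^ 2) := by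
    have := sq_sum_le_card_mul_sum_sq (s := Finset.univ) (f := fun l => |1 - β * N.weight l k|)
    simp only [sq_abs, Finset.card_univ, Fintype.card_fin] at this
    exact this.trans (mul_le_mul_of_nonneg_left hsq hK.le)
  refine abs_le_of_sq_le_sq' ?_ (by positivity) |>.2
  rw [mul_pow, mul_pow, Real.sq_sqrt hK.le, mul_assoc]
  exact hcs

theorem mem_nbhd_of_weight_ne_zero {l k : Fin K} (h : N.weight l k ≠ 0) : l ∈ N.nbhd k := by
  simp only [nbhd, hop, Finset.mem_filter, Finset.mem_univ, true_and]
  by_cases hlk : l = k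
  · simp [hlk]
  · have := (N.adj_iff l k hlk).2 (lt_of_le_of_ne (N.weight_nonneg l k) h.symm)
    exact (SimpleGraph.dist_eq_one_iff_adj.2 this.symm).le

theorem hop_mono (k : Fin K) : Monotone (N.hop k) := fun m n h l hl => by
  simp only [hop, Finset.mem_filter, Finset.mem_univ, true_and] at hl ⊢
  exact hl.trans h

theorem exists_hop_eq_univ (k : Fin K) : ∃ n, 1 ≤ n ∧ N.hop k n = Finset.univ := by
  refine ⟨1 + ∑ l, N.graph.dist k l, by omega, ?_⟩
  ext l
  simp only [hop, Finset.mem_filter, Finset.mem_univ, true_and, iff_true]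
  have := Finset.single_le_sum (f := fun l => N.graph.dist k l) (fun _ _ => Nat.zero_le _)
    (Finset.mem_univ l)
  omega

theorem minDeg_le (k : Fin K) : N.minDeg ≤ (N.nbhd k).card :=
  ciInf_le (OrderBot.bddBelow _) k

end Network

/-! ### Strong data processing: contraction of the divergence by the Dobrushin coefficient. -/

section Contraction

/-- Thresholds γ ≥ 1 see only ratios x above one, and thresholds γ ≤ 1 in `integral_max_one_sub_div`
only those below; together they make up x log x − x + 1. Any cutoff `M` above x gives the same
value, since the hinge vanishes beyond x. -/
theorem integral_max_sub_div_of_le {x M : ℝ} (hM : 1 ≤ M) (hxM : x ≤ M) :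
    ∫ γ in (1 : ℝ)..M, max (x / γ - 1) 0 = if x ≤ 1 then 0 else x * Real.log x - x + 1 := by
  split_ifs with h
  · rw [intervalIntegral.integral_congr (g := fun _ => 0)]
    · simp
    · intro γ hγ
      rw [Set.uIcc_of_le hM] at hγ
      refine max_eq_right ?_
      have : x / γ ≤ 1 := (div_le_one (by linarith [hγ.1])).2 (h.trans hγ.1)
      linarith
  · push Not at h
    have hcont : ∀ c d : ℝ, 1 ≤ c → 1 ≤ d →
        IntervalIntegrable (fun γ : ℝ => max (x / γ - 1) 0) volume c d := by
      intro c d hc hd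
      refine ContinuousOn.intervalIntegrable ?_
      have : ∀ γ ∈ Set.uIcc c d, γ ≠ 0 := fun γ hγ =>
        (lt_of_lt_of_le one_pos ((le_min hc hd).trans hγ.1)).ne'
      exact ((continuousOn_const.div continuousOn_id this).sub continuousOn_const).sup
        continuousOn_const
    rw [← intervalIntegral.integral_add_adjacent_intervals (hcont 1 x le_rfl h.le)
      (hcont x M h.le hM)]
    have h1 : ∫ γ in (1 : ℝ)..x, max (x / γ - 1) 0 = ∫ γ in (1 : ℝ)..x, (x * γ⁻¹ - 1) := by
      refine intervalIntegral.integral_congr fun γ hγ => ?_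
      rw [Set.uIcc_of_le h.le] at hγ
      have : 1 ≤ x / γ := (one_le_div (by linarith [hγ.1])).2 hγ.2
      simp only [div_eq_mul_inv] at this ⊢
      exact max_eq_left (by linarith)
    have h2 : ∫ γ in x..M, max (x / γ - 1) 0 = ∫ γ in x..M, (0 : ℝ) := by
      refine intervalIntegral.integral_congr fun γ hγ => ?_
      rw [Set.uIcc_of_le hxM] at hγ
      refine max_eq_right ?_
      have : x / γ ≤ 1 := (div_le_one (by linarith [hγ.1])).2 hγ.1
      linarith
    have h3 : IntervalIntegrable (fun γ : ℝ => γ⁻¹) volume 1 x := by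
      refine intervalIntegral.intervalIntegrable_inv (fun γ hγ => ?_) continuousOn_id
      rw [Set.uIcc_of_le h.le] at hγ
      exact (lt_of_lt_of_le one_pos hγ.1).ne'
    rw [h1, h2, intervalIntegral.integral_sub (h3.const_mul x) intervalIntegrable_const,
      intervalIntegral.integral_const_mul, integral_inv_of_pos one_pos (by linarith)]
    simp
    ring

theorem intervalIntegrable_max_div_sub {p q M : ℝ} (hM : 1 ≤ M) :
    IntervalIntegrable (fun γ : ℝ => max (p / γ - q) 0) volume 1 M := by
  refine ContinuousOn.intervalIntegrable ?_
  rw [Set.uIcc_of_le hM]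
  have : ∀ γ ∈ Set.Icc 1 M, γ ≠ 0 := fun γ hγ => (lt_of_lt_of_le one_pos hγ.1).ne'
  exact ((continuousOn_const.div continuousOn_id this).sub continuousOn_const).sup
    continuousOn_const

/-- The singular quotient at 0 enters with a minus sign, so the hinge stays between 0 and q. -/
theorem intervalIntegrable_max_sub_div {p q : ℝ} (hp : 0 ≤ p) (hq : 0 ≤ q) :
    IntervalIntegrable (fun γ : ℝ => max (q - p / γ) 0) volume 0 1 := by
  rw [intervalIntegrable_iff_integrableOn_Ioc_of_le zero_le_one]
  refine Measure.integrableOn_of_bounded (M := q) (by simp)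
    (by fun_prop : Measurable _).aestronglyMeasurable ?_
  refine (ae_restrict_mem measurableSet_Ioc).mono fun γ hγ => ?_
  rw [Real.norm_eq_abs, abs_of_nonneg (le_max_right _ _)]
  exact max_le (by linarith [div_nonneg hp hγ.1.le]) hq

theorem integral_max_one_sub_div {x : ℝ} (hx : 0 ≤ x) :
    ∫ γ in (0 : ℝ)..1, max (1 - x / γ) 0 = if x ≤ 1 then x * Real.log x - x + 1 else 0 := by
  split_ifs with h
  · rcases hx.eq_or_lt with rfl | hx0
    · simp
    have hi := intervalIntegrable_max_sub_div hx zero_le_one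
    have hs : Set.uIcc 0 x ⊆ Set.uIcc (0 : ℝ) 1 := by
      rw [Set.uIcc_of_le hx, Set.uIcc_of_le zero_le_one]; exact Set.Icc_subset_Icc_right h
    have hs' : Set.uIcc x 1 ⊆ Set.uIcc (0 : ℝ) 1 := by
      rw [Set.uIcc_of_le h, Set.uIcc_of_le zero_le_one]; exact Set.Icc_subset_Icc_left hx
    rw [← intervalIntegral.integral_add_adjacent_intervals (hi.mono_set hs) (hi.mono_set hs')]
    have h1 : ∫ γ in (0 : ℝ)..x, max (1 - x / γ) 0 = ∫ γ in (0 : ℝ)..x, (0 : ℝ) := by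
      refine intervalIntegral.integral_congr_ae (ae_of_all _ fun γ hγ => ?_)
      rw [Set.uIoc_of_le hx] at hγ
      refine max_eq_right ?_
      have : 1 ≤ x / γ := (one_le_div hγ.1).2 hγ.2
      linarith
    have h2 : ∫ γ in x..1, max (1 - x / γ) 0 = ∫ γ in x..1, (1 - x * γ⁻¹) := by
      refine intervalIntegral.integral_congr fun γ hγ => ?_
      rw [Set.uIcc_of_le h] at hγ
      have : x / γ ≤ 1 := (div_le_one (by linarith [hγ.1])).2 hγ.1
      simp only [div_eq_mul_inv] at this ⊢
      exact max_eq_left (by linarith)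
    have h3 : IntervalIntegrable (fun γ : ℝ => γ⁻¹) volume x 1 := by
      refine intervalIntegral.intervalIntegrable_inv (fun γ hγ => ?_) continuousOn_id
      rw [Set.uIcc_of_le h] at hγ
      exact (lt_of_lt_of_le hx0 hγ.1).ne'
    rw [h1, h2, intervalIntegral.integral_sub intervalIntegrable_const (h3.const_mul x),
      intervalIntegral.integral_const_mul, integral_inv_of_pos hx0 one_pos]
    simp
    ring
  · push Not at h
    rw [intervalIntegral.integral_congr_ae (g := fun _ => 0)]
    · simp
    · refine ae_of_all _ fun γ hγ => ?_
      rw [Set.uIoc_of_le zero_le_one] at hγ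
      refine max_eq_right ?_
      have : 1 ≤ x / γ := (one_le_div hγ.1).2 (by linarith [hγ.2])
      linarith

/-- `klFun` as a mixture of hinge functions. -/
theorem mul_klFun_div_eq_integral {p q M : ℝ} (hp : 0 ≤ p) (hq : 0 ≤ q) (hM : 1 ≤ M)
    (hpM : p ≤ M * q) :
    q * klFun (p / q) = (∫ γ in (1 : ℝ)..M, max (p / γ - q) 0) +
      ∫ γ in (0 : ℝ)..1, max (q - p / γ) 0 := by
  rcases hq.eq_or_lt with rfl | hq0
  · have : p = 0 := le_antisymm (by simpa using hpM) hp
    simp [this]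
  have hx : 0 ≤ p / q := div_nonneg hp hq
  have hxM : p / q ≤ M := (div_le_iff₀ hq0).2 hpM
  have e1 : ∀ γ : ℝ, max (p / γ - q) 0 = q * max (p / q / γ - 1) 0 := fun γ => by
    rw [mul_max_of_nonneg _ _ hq, mul_zero]
    congr 1
    field_simp
  have e2 : ∀ γ : ℝ, max (q - p / γ) 0 = q * max (1 - p / q / γ) 0 := fun γ => by
    rw [mul_max_of_nonneg _ _ hq, mul_zero]
    congr 1
    field_simp
  simp only [e1, e2, intervalIntegral.integral_const_mul, integral_max_sub_div_of_le hM hxM,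
    integral_max_one_sub_div hx, klFun]
  split_ifs <;> ring

variable {S : Type*} [Fintype S]

/-- Kullback-Leibler divergence of two vectors, for `p` absolutely continuous with respect
to `q`. -/
noncomputable def klSum (p q : S → ℝ) : ℝ := ∑ s, q s * klFun (p s / q s)

/-- A stochastic kernel contracts the positive part of a vector of nonpositive mass by its
Dobrushin coefficient. -/
theorem sum_max_kernel_le {T : S → S → ℝ} (hT : ∀ s s', 0 ≤ T s s') (hT1 : ∀ s', ∑ s, T s s' = 1)
    {κ : ℝ} (hκ : ∀ s' s'', (1 / 2 : ℝ) * ∑ s, |T s s' - T s s''| ≤ κ)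
    {v : S → ℝ} (hv : ∑ s, v s ≤ 0) :
    ∑ s, max (∑ s', T s s' * v s') 0 ≤ κ * ∑ s, max (v s) 0 := by
  have hsplit : ∀ s, v s = max (v s) 0 - max (-v s) 0 := fun s => by
    rcases le_total (v s) 0 with h | h
    · rw [max_eq_right h, max_eq_left (by linarith)]; ring
    · rw [max_eq_left h, max_eq_right (by linarith)]; ring
  set p : S → ℝ := fun s => max (v s) 0 with hp
  set n : S → ℝ := fun s => max (-v s) 0 with hn
  have hp0 : ∀ s, 0 ≤ p s := fun s => le_max_right _ _
  have hn0 : ∀ s, 0 ≤ n s := fun s => le_max_right _ _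
  have hle : ∑ s, p s ≤ ∑ s, n s := by
    have : ∑ s, v s = ∑ s, p s - ∑ s, n s := by
      rw [← Finset.sum_sub_distrib]; exact Finset.sum_congr rfl fun s _ => hsplit s
    linarith
  have hpos : ∀ s' s'', ∑ s, max (T s s' - T s s'') 0 ≤ κ := by
    intro s' s''
    have h1 : ∀ s, max (T s s' - T s s'') 0
        = (1 / 2) * |T s s' - T s s''| + (1 / 2) * (T s s' - T s s'') := fun s => by
      rcases le_total (T s s' - T s s'') 0 with h | h
      · rw [max_eq_right h, abs_of_nonpos h]; ring
      · rw [max_eq_left h, abs_of_nonneg h]; ring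
    simp only [h1, Finset.sum_add_distrib, ← Finset.mul_sum, Finset.sum_sub_distrib, hT1]
    simpa using hκ s' s''
  set b := ∑ s, n s with hb
  have hb0 : 0 ≤ b := Finset.sum_nonneg fun s _ => hn0 s
  rcases hb0.eq_or_lt with hb1 | hb1
  · have hp1 : ∑ s, p s = 0 := le_antisymm (hle.trans hb1.symm.le)
      (Finset.sum_nonneg fun s _ => hp0 s)
    have hpz : ∀ s, p s = 0 := fun s =>
      (Finset.sum_eq_zero_iff_of_nonneg (fun s _ => hp0 s)).1 hp1 s (Finset.mem_univ s)
    have hvz : ∀ s, v s ≤ 0 := fun s => by have := hpz s; simp only [hp] at this; simpa using this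
    rw [hp1, mul_zero]
    refine (Finset.sum_eq_zero fun s _ => max_eq_right ?_).le
    exact Finset.sum_nonpos fun s' _ => mul_nonpos_of_nonneg_of_nonpos (hT s s') (hvz s')
  -- Transport the positive part along the plan p ⊗ n / b. Its first marginal is p and its second is
  -- a fraction (Σ p)/b ≤ 1 of n, so the part of n left unmatched only helps the inequality. Each
  -- matched pair contributes a difference of two columns of `T`, whose positive part has mass at
  -- most κ.
  have hpt : ∀ s, max (∑ s', T s s' * v s') 0
      ≤ ∑ s', ∑ s'', p s' * n s'' / b * max (T s s' - T s s'') 0 := by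
    intro s
    refine max_le ?_ (Finset.sum_nonneg fun s' _ => Finset.sum_nonneg fun s'' _ =>
      mul_nonneg (div_nonneg (mul_nonneg (hp0 _) (hn0 _)) hb0) (le_max_right _ _))
    have h2 : ∑ s', ∑ s'', p s' * n s'' / b * (T s s' - T s s'')
        = ∑ s', T s s' * p s' - (∑ s', p s') / b * ∑ s'', T s s'' * n s'' := by
      have : ∀ s' s'', p s' * n s'' / b * (T s s' - T s s'')
          = T s s' * p s' / b * n s'' - p s' / b * (T s s'' * n s'') := fun _ _ => by ring
      simp only [this, Finset.sum_sub_distrib, ← Finset.mul_sum, ← Finset.sum_mul, ← hb,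
        ← Finset.sum_div]
      field_simp
    have h3 : ∑ s', T s s' * v s' = ∑ s', T s s' * p s' - ∑ s'', T s s'' * n s'' := by
      rw [← Finset.sum_sub_distrib]
      refine Finset.sum_congr rfl fun s' _ => ?_
      rw [hsplit s']; ring
    have h4 : (∑ s', p s') / b ≤ 1 := (div_le_one hb1).2 hle
    have h5 : 0 ≤ ∑ s'', T s s'' * n s'' :=
      Finset.sum_nonneg fun s'' _ => mul_nonneg (hT _ _) (hn0 _)
    calc ∑ s', T s s' * v s' ≤ ∑ s', ∑ s'', p s' * n s'' / b * (T s s' - T s s'') := by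
          rw [h2, h3]; nlinarith
      _ ≤ _ := Finset.sum_le_sum fun s' _ => Finset.sum_le_sum fun s'' _ =>
          mul_le_mul_of_nonneg_left (le_max_left _ _)
            (div_nonneg (mul_nonneg (hp0 _) (hn0 _)) hb0)
  calc ∑ s, max (∑ s', T s s' * v s') 0
      ≤ ∑ s, ∑ s', ∑ s'', p s' * n s'' / b * max (T s s' - T s s'') 0 :=
        Finset.sum_le_sum fun s _ => hpt s
    _ = ∑ s', ∑ s'', p s' * n s'' / b * ∑ s, max (T s s' - T s s'') 0 := by
        rw [Finset.sum_comm]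
        refine Finset.sum_congr rfl fun s' _ => ?_
        rw [Finset.sum_comm]
        simp only [Finset.mul_sum]
    _ ≤ ∑ s', ∑ s'', p s' * n s'' / b * κ :=
        Finset.sum_le_sum fun s' _ => Finset.sum_le_sum fun s'' _ =>
          mul_le_mul_of_nonneg_left (hpos _ _) (div_nonneg (mul_nonneg (hp0 _) (hn0 _)) hb0)
    _ = κ * ∑ s, p s := by
        have : ∀ s' s'', p s' * n s'' / b * κ = κ * p s' / b * n s'' := fun _ _ => by ring
        simp only [this, ← Finset.mul_sum, ← hb]
        rw [Finset.mul_sum]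
        refine Finset.sum_congr rfl fun s' _ => ?_
        field_simp

theorem intervalIntegrable_sum_univ {f : S → ℝ → ℝ} {a b : ℝ}
    (h : ∀ s, IntervalIntegrable (f s) volume a b) :
    IntervalIntegrable (fun γ => ∑ s, f s γ) volume a b := by
  have := IntervalIntegrable.sum Finset.univ fun s _ => h s
  rwa [show (∑ s, f s) = fun γ => ∑ s, f s γ from funext fun γ => Finset.sum_apply _ _ _] at this

theorem klSum_eq_integral {p q : S → ℝ} (hp : ∀ s, 0 ≤ p s) (hq : ∀ s, 0 ≤ q s) {M : ℝ}
    (hM : 1 ≤ M) (hpM : ∀ s, p s ≤ M * q s) :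
    klSum p q = (∫ γ in (1 : ℝ)..M, ∑ s, max (p s / γ - q s) 0) +
      ∫ γ in (0 : ℝ)..1, ∑ s, max (q s - p s / γ) 0 := by
  rw [intervalIntegral.integral_finsetSum fun s _ => intervalIntegrable_max_div_sub hM,
    intervalIntegral.integral_finsetSum fun s _ => intervalIntegrable_max_sub_div (hp s) (hq s),
    ← Finset.sum_add_distrib]
  exact Finset.sum_congr rfl fun s _ => mul_klFun_div_eq_integral (hp s) (hq s) hM (hpM s)

/-- **Strong data processing inequality**: a stochastic kernel contracts the Kullback-Leibler
divergence by its Dobrushin coefficient. -/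
theorem klSum_kernel_le {T : S → S → ℝ} (hT : ∀ s s', 0 ≤ T s s') (hT1 : ∀ s', ∑ s, T s s' = 1)
    {κ : ℝ} (hκ : ∀ s' s'', (1 / 2 : ℝ) * ∑ s, |T s s' - T s s''| ≤ κ)
    {p q : S → ℝ} (hp : ∀ s, 0 ≤ p s) (hq : ∀ s, 0 ≤ q s) (hpq : ∑ s, p s = ∑ s, q s)
    (hac : ∀ s, q s = 0 → p s = 0) :
    klSum (fun s => ∑ s', T s s' * p s') (fun s => ∑ s', T s s' * q s') ≤ κ * klSum p q := by
  -- One cutoff above all ratios p/q; kernels preserve p ≤ M q, so it serves the images as well.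
  set M : ℝ := 1 + ∑ s, p s / q s with hMdef
  have hM : 1 ≤ M := le_add_of_nonneg_right (Finset.sum_nonneg fun s _ => div_nonneg (hp s) (hq s))
  have hpM : ∀ s, p s ≤ M * q s := by
    intro s
    rcases (hq s).eq_or_lt with h | h
    · rw [← h, hac s h.symm]; simp
    · rw [← div_le_iff₀ h]
      have := Finset.single_le_sum (fun s _ => div_nonneg (hp s) (hq s)) (Finset.mem_univ s)
      linarith
  have hTp : ∀ s, 0 ≤ ∑ s', T s s' * p s' := fun s =>
    Finset.sum_nonneg fun s' _ => mul_nonneg (hT _ _) (hp _)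
  have hTq : ∀ s, 0 ≤ ∑ s', T s s' * q s' := fun s =>
    Finset.sum_nonneg fun s' _ => mul_nonneg (hT _ _) (hq _)
  have hTM : ∀ s, ∑ s', T s s' * p s' ≤ M * ∑ s', T s s' * q s' := by
    intro s
    rw [Finset.mul_sum]
    refine Finset.sum_le_sum fun s' _ => ?_
    calc T s s' * p s' ≤ T s s' * (M * q s') := mul_le_mul_of_nonneg_left (hpM s') (hT _ _)
      _ = M * (T s s' * q s') := by ring
  rw [klSum_eq_integral hTp hTq hM hTM, klSum_eq_integral hp hq hM hpM, mul_add,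
    ← intervalIntegral.integral_const_mul, ← intervalIntegral.integral_const_mul]
  refine add_le_add (intervalIntegral.integral_mono_on hM ?_ ?_ ?_)
    (intervalIntegral.integral_mono_on_of_le_Ioo zero_le_one ?_ ?_ ?_)
  · exact intervalIntegrable_sum_univ fun s => intervalIntegrable_max_div_sub hM
  · exact (intervalIntegrable_sum_univ fun s => intervalIntegrable_max_div_sub hM).const_mul κ
  · intro γ hγ
    -- For γ ≥ 1 the vector p/γ − q has nonpositive mass; for γ ≤ 1 it is q − p/γ that does. The
    -- hinge representation uses in each range the side to which the contraction applies.
    have h := sum_max_kernel_le hT hT1 hκ (v := fun s => p s / γ - q s) (by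
      rw [Finset.sum_sub_distrib, ← Finset.sum_div, hpq, sub_nonpos]
      exact div_le_self (Finset.sum_nonneg fun s _ => hq s) hγ.1)
    refine le_trans (le_of_eq (Finset.sum_congr rfl fun s _ => ?_)) h
    rw [Finset.sum_div, ← Finset.sum_sub_distrib]
    congr 1
    exact Finset.sum_congr rfl fun s' _ => by ring
  · exact intervalIntegrable_sum_univ fun s => intervalIntegrable_max_sub_div (hTp s) (hTq s)
  · exact (intervalIntegrable_sum_univ fun s =>
      intervalIntegrable_max_sub_div (hp s) (hq s)).const_mul κ
  -- The endpoint γ = 0 has to stay excluded: there division by zero gives p/γ = 0, and the mass of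
  -- q − p/γ is no longer nonpositive.
  · intro γ hγ
    have h := sum_max_kernel_le hT hT1 hκ (v := fun s => q s - p s / γ) (by
      rw [Finset.sum_sub_distrib, ← Finset.sum_div, hpq, sub_nonpos]
      exact le_div_self (Finset.sum_nonneg fun s _ => hq s) hγ.1 hγ.2.le)
    refine le_trans (le_of_eq (Finset.sum_congr rfl fun s _ => ?_)) h
    rw [Finset.sum_div, ← Finset.sum_sub_distrib]
    congr 1
    exact Finset.sum_congr rfl fun s' _ => by ring

end Contraction

/-! ### Averaged transition models, and the cost of ignoring distant actions. -/

section Transitions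

variable {K : ℕ} {S : Type*} {A O : Fin K → Type*} [Fintype S] [∀ k, Fintype (A k)]
  [∀ k, MeasurableSpace (O k)]

theorem pointBelief_mem_stdSimplex (s : S) : pointBelief s ∈ stdSimplex ℝ S := by
  classical
  unfold pointBelief
  exact single_mem_stdSimplex ℝ s

namespace DecPOMDP

variable (M : DecPOMDP K S A O)

theorem localTrans_nonneg (π : JointPolicy K S A) (H : Finset (Fin K)) (s s' : S) (a : ∀ k, A k) :
    0 ≤ M.localTrans π H s s' a :=
  Finset.sum_nonneg fun _ _ => mul_nonneg (M.trans_nonneg _ _ _) <| Finset.prod_nonneg fun l _ =>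
    π.prob_nonneg l _ (pointBelief_mem_stdSimplex s') _

open Classical in
theorem sum_localTrans (π : JointPolicy K S A) (H : Finset (Fin K)) (s' : S) (a : ∀ k, A k) :
    ∑ s, M.localTrans π H s s' a = 1 := by
  simp only [localTrans]
  rw [Finset.sum_comm]
  simp_rw [← Finset.sum_mul, M.trans_sum, one_mul]
  have h1 : (Finset.univ.filter fun a' : ∀ k, A k => ∀ l ∈ H, a' l = a l)
      = Fintype.piFinset fun l => if l ∈ H then {a l} else Finset.univ := by
    ext a'
    simp only [Finset.mem_filter, Finset.mem_univ, true_and, Fintype.mem_piFinset]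
    refine forall_congr' fun l => ?_
    by_cases hl : l ∈ H <;> simp [hl]
  have h2 : ∀ a' : ∀ k, A k, ∏ l ∈ Hᶜ, π.prob l (pointBelief s') (a' l)
      = ∏ l, if l ∈ H then 1 else π.prob l (pointBelief s') (a' l) := by
    intro a'
    rw [← Finset.prod_mul_prod_compl H]
    rw [Finset.prod_eq_one (s := H) (fun l hl => by simp [hl]), one_mul]
    exact Finset.prod_congr rfl fun l hl => by simp [Finset.mem_compl.mp hl]
  simp_rw [h2]
  rw [h1, ← Finset.prod_univ_sum (fun l => if l ∈ H then {a l} else Finset.univ)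
    (fun l (b : A l) => if l ∈ H then (1 : ℝ) else π.prob l (pointBelief s') b)]
  refine Finset.prod_eq_one fun l _ => ?_
  by_cases hl : l ∈ H
  · simp [hl]
  · simp [hl, π.prob_sum l _ (pointBelief_mem_stdSimplex s')]

theorem localTrans_univ (π : JointPolicy K S A) (s s' : S) (a : ∀ k, A k) :
    M.localTrans π Finset.univ s s' a = M.trans s s' a := by
  classical
  rw [localTrans, Finset.sum_eq_single a]
  · simp
  · intro b hb hne
    exact absurd (funext fun l => (Finset.mem_filter.1 hb).2 l (Finset.mem_univ l)) hne
  · simp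

theorem dobrushin_nonneg (a : ∀ k, A k) : 0 ≤ M.dobrushin a :=
  Real.iSup_nonneg fun p => by positivity

theorem le_of_dobrushin_le {a : ∀ k, A k} {κ : ℝ} (h : M.dobrushin a ≤ κ) (s' s'' : S) :
    (1 / 2 : ℝ) * ∑ s, |M.trans s s' a - M.trans s s'' a| ≤ κ :=
  (le_ciSup (f := fun p : S × S => (1 / 2 : ℝ) * ∑ s, |M.trans s p.1 a - M.trans s p.2 a|)
    (Set.finite_range _).bddAbove (s', s'')).trans h

namespace HopBound

variable {M} {π : JointPolicy K S A} {N : Network K} {τ : ℝ}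

/-- The constant bounds an absolute value as soon as one transition probability is nonzero. Such a
probability exists: policies are probability vectors, so action sets are nonempty, and the averaged
transitions sum to one. -/
theorem nonneg [Nonempty S] (h : M.HopBound π N τ) : 0 ≤ τ := by
  obtain ⟨k, -⟩ := N.self_weight
  obtain ⟨s'⟩ := ‹Nonempty S›
  have hA : ∀ l, Nonempty (A l) := fun l => by
    by_contra hne
    rw [not_nonempty_iff] at hne
    have := π.prob_sum l _ (pointBelief_mem_stdSimplex s')
    simp at this
  set a : ∀ l, A l := fun l => (hA l).some
  obtain ⟨s, -, hs⟩ := Finset.exists_ne_zero_of_sum_ne_zero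
    ((M.sum_localTrans π (N.hop k 1) s' a).trans_ne one_ne_zero)
  exact (abs_nonneg _).trans (h.log_le k 1 le_rfl s s' a hs)

theorem localTrans_succ_le (h : M.HopBound π N τ) {k : Fin K} {n : ℕ} (hn : 1 ≤ n) (s s' : S)
    (a : ∀ k, A k) : M.localTrans π (N.hop k (n + 1)) s s' a
      ≤ Real.exp τ * M.localTrans π (N.hop k n) s s' a := by
  by_cases h0 : M.localTrans π (N.hop k n) s s' a = 0
  · rw [h0, (h.supp k n hn s s' a).1 h0, mul_zero]
  · have h1 := fun h' => h0 ((h.supp k n hn s s' a).2 h')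
    have hp := lt_of_le_of_ne (M.localTrans_nonneg π (N.hop k n) s s' a) (Ne.symm h0)
    have hp1 := lt_of_le_of_ne (M.localTrans_nonneg π (N.hop k (n + 1)) s s' a) (Ne.symm h1)
    have h2 := (abs_le.1 (h.log_le k n hn s s' a h0)).1
    rw [Real.log_div h0 h1] at h2
    rw [← Real.log_le_log_iff hp1 (by positivity), Real.log_mul (Real.exp_ne_zero _) h0,
      Real.log_exp]
    linarith

/-- A hop costs a factor e^τ only if the neighbourhood grows, and then it gains at least one agent.
The exponent therefore counts agents and not hops. -/
theorem localTrans_hop_le [Nonempty S] (h : M.HopBound π N τ) (k : Fin K) {n : ℕ} (hn : 1 ≤ n)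
    (s s' : S) (a : ∀ k, A k) : M.localTrans π (N.hop k n) s s' a
      ≤ Real.exp ((((N.hop k n).card : ℝ) - (N.nbhd k).card) * τ) *
        M.localTrans π (N.nbhd k) s s' a := by
  induction n, hn using Nat.le_induction with
  | base => simp [Network.nbhd]
  | succ n hn ih =>
    rcases (N.hop_mono k n.le_succ).eq_or_ssubset with heq | hss
    · rw [← heq]; exact ih
    · have hc : ((N.hop k n).card : ℝ) + 1 ≤ (N.hop k (n + 1)).card := by
        exact_mod_cast Finset.card_lt_card hss
      calc M.localTrans π (N.hop k (n + 1)) s s' a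
          ≤ Real.exp τ * (Real.exp ((((N.hop k n).card : ℝ) - (N.nbhd k).card) * τ) *
            M.localTrans π (N.nbhd k) s s' a) :=
            (h.localTrans_succ_le hn s s' a).trans
              (mul_le_mul_of_nonneg_left ih (Real.exp_pos _).le)
        _ ≤ _ := by
          rw [← mul_assoc, ← Real.exp_add]
          refine mul_le_mul_of_nonneg_right (Real.exp_le_exp.2 ?_) (M.localTrans_nonneg _ _ _ _ _)
          nlinarith [h.nonneg]

/-- The full transition model is bounded by the local one up to `exp ((K - d_min) τ)`. -/
theorem trans_le [Nonempty S] (h : M.HopBound π N τ) (k : Fin K) (s s' : S) (a : ∀ k, A k) :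
    M.trans s s' a ≤ Real.exp (((K : ℝ) - N.minDeg) * τ) * M.localTrans π (N.nbhd k) s s' a := by
  obtain ⟨n, hn, hu⟩ := N.exists_hop_eq_univ k
  have h1 := h.localTrans_hop_le k hn s s' a
  rw [hu, localTrans_univ, Finset.card_univ, Fintype.card_fin] at h1
  refine h1.trans (mul_le_mul_of_nonneg_right (Real.exp_le_exp.2 ?_)
    (M.localTrans_nonneg _ _ _ _ _))
  have : (N.minDeg : ℝ) ≤ (N.nbhd k).card := by exact_mod_cast N.minDeg_le k
  exact mul_le_mul_of_nonneg_right (by linarith) h.nonneg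

/-- The supports agree along the whole chain of hop neighbourhoods, from the nearest to the full
network. This is what keeps the supports of local and central priors equal. -/
theorem localTrans_eq_zero_iff (h : M.HopBound π N τ) (k : Fin K) (s s' : S) (a : ∀ k, A k) :
    M.localTrans π (N.nbhd k) s s' a = 0 ↔ M.trans s s' a = 0 := by
  obtain ⟨n, hn, hu⟩ := N.exists_hop_eq_univ k
  have h1 : ∀ n, 1 ≤ n → (M.localTrans π (N.nbhd k) s s' a = 0 ↔
      M.localTrans π (N.hop k n) s s' a = 0) := by
    intro n hn
    induction n, hn using Nat.le_induction with
    | base => rfl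
    | succ n hn ih => exact ih.trans (h.supp k n hn s s' a)
  rw [h1 n hn, hu, localTrans_univ]

end HopBound

end DecPOMDP

end Transitions

/-! ### Bounds for one update and one prediction along a fixed path. -/

section Pathwise

variable {K : ℕ} {S : Type*} {A O : Fin K → Type*} [Fintype S] [∀ k, Fintype (A k)]
  [∀ k, MeasurableSpace (O k)]

theorem rescale_nonneg {f : S → ℝ} (hf : ∀ s, 0 ≤ f s) (s : S) : 0 ≤ rescale f s :=
  div_nonneg (hf s) (Finset.sum_nonneg fun s _ => hf s)

theorem rescale_le_one {f : S → ℝ} (hf : ∀ s, 0 ≤ f s) (s : S) : rescale f s ≤ 1 :=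
  div_le_one_of_le₀ (Finset.single_le_sum (fun s _ => hf s) (Finset.mem_univ s))
    (Finset.sum_nonneg fun s _ => hf s)

theorem rescale_mem_stdSimplex {f : S → ℝ} (hf : ∀ s, 0 ≤ f s) (h : 0 < ∑ s, f s) :
    rescale f ∈ stdSimplex ℝ S :=
  ⟨rescale_nonneg hf, by simp only [rescale, ← Finset.sum_div]; exact div_self h.ne'⟩

theorem rescale_const_mul {c : ℝ} (hc : c ≠ 0) (f : S → ℝ) :
    rescale (fun s => c * f s) = rescale f := by
  funext s
  simp only [rescale, ← Finset.mul_sum]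
  exact mul_div_mul_left _ _ hc

/-- If the total mass is zero then `f` vanishes and both sides are zero. Bayes' rule can thus be
used without excluding observations of zero predictive density. -/
theorem sum_mul_rescale {f : S → ℝ} (hf : ∀ s, 0 ≤ f s) (s : S) :
    (∑ t, f t) * rescale f s = f s := by
  by_cases h : ∑ t, f t = 0
  · rw [h, zero_mul, (Finset.sum_eq_zero_iff_of_nonneg fun s _ => hf s).1 h s (Finset.mem_univ s)]
  · exact mul_div_cancel₀ _ h

theorem exists_pos_of_mem_stdSimplex {p : S → ℝ} (hp : p ∈ stdSimplex ℝ S) : ∃ s, 0 < p s := by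
  obtain ⟨s, -, hs⟩ := Finset.exists_ne_zero_of_sum_ne_zero (hp.2.trans_ne one_ne_zero)
  exact ⟨s, lt_of_le_of_ne (hp.1 s) hs.symm⟩

/-- The terms of `klSum` differ from p log(p/q) by q − p, which makes each of them nonnegative and
cancels in the sum over probability vectors. -/
theorem klSum_eq_sum_mul_log {p q : S → ℝ} (hp : p ∈ stdSimplex ℝ S) (hq : q ∈ stdSimplex ℝ S)
    (hac : ∀ s, q s = 0 → p s = 0) : klSum p q = ∑ s, p s * Real.log (p s / q s) := by
  have h : ∀ s, q s * klFun (p s / q s) = p s * Real.log (p s / q s) + (q s - p s) := fun s => by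
    by_cases h0 : q s = 0
    · simp [h0, hac s h0]
    · rw [klFun]; field_simp; ring
  simp only [klSum, h, Finset.sum_add_distrib, Finset.sum_sub_distrib, hp.2, hq.2, sub_self,
    add_zero]

theorem klSum_nonneg {p q : S → ℝ} (hp : ∀ s, 0 ≤ p s) (hq : ∀ s, 0 ≤ q s) : 0 ≤ klSum p q :=
  Finset.sum_nonneg fun s _ => mul_nonneg (hq s) (klFun_nonneg (div_nonneg (hp s) (hq s)))

/-- A centralized belief together with local beliefs that have the same support. -/
structure SameSupport (η : S → ℝ) (ηs : Fin K → S → ℝ) : Prop where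
  central : η ∈ stdSimplex ℝ S
  local_mem : ∀ k, ηs k ∈ stdSimplex ℝ S
  eq_zero_iff : ∀ k s, ηs k s = 0 ↔ η s = 0

theorem SameSupport.pos {η : S → ℝ} {ηs : Fin K → S → ℝ} (h : SameSupport η ηs) (k : Fin K)
    {s : S} (hs : 0 < η s) : 0 < ηs k s :=
  lt_of_le_of_ne ((h.local_mem k).1 s) fun h0 => hs.ne' ((h.eq_zero_iff k s).1 h0.symm)

/-- The divergence after a change of the kernel that is bounded by `exp c`. -/
theorem klSum_kernel_le_add {T U : S → S → ℝ} (hT : ∀ s s', 0 ≤ T s s')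
    (hT1 : ∀ s', ∑ s, T s s' = 1) (hU : ∀ s s', 0 ≤ U s s') (hU1 : ∀ s', ∑ s, U s s' = 1)
    {κ c : ℝ} (hκ : ∀ s' s'', (1 / 2 : ℝ) * ∑ s, |T s s' - T s s''| ≤ κ)
    (hTU : ∀ s s', T s s' ≤ Real.exp c * U s s')
    {p q : S → ℝ} (hp : p ∈ stdSimplex ℝ S) (hq : q ∈ stdSimplex ℝ S)
    (hac : ∀ s, q s = 0 → p s = 0) :
    klSum (fun s => ∑ s', T s s' * p s') (fun s => ∑ s', U s s' * q s') ≤ κ * klSum p q + c := by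
  have hmem : ∀ {V : S → S → ℝ} {r : S → ℝ}, (∀ s s', 0 ≤ V s s') → (∀ s', ∑ s, V s s' = 1) →
      r ∈ stdSimplex ℝ S → (fun s => ∑ s', V s s' * r s') ∈ stdSimplex ℝ S := by
    intro V r hV hV1 hr
    refine ⟨fun s => Finset.sum_nonneg fun s' _ => mul_nonneg (hV s s') (hr.1 s'), ?_⟩
    rw [Finset.sum_comm]
    simp only [← Finset.sum_mul, hV1, one_mul, hr.2]
  have hTUq : ∀ s, ∑ s', T s s' * q s' ≤ Real.exp c * ∑ s', U s s' * q s' := fun s => by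
    rw [Finset.mul_sum]
    refine Finset.sum_le_sum fun s' _ => ?_
    rw [← mul_assoc]
    exact mul_le_mul_of_nonneg_right (hTU s s') (hq.1 s')
  have hac1 : ∀ s, ∑ s', T s s' * q s' = 0 → ∑ s', T s s' * p s' = 0 := fun s h => by
    refine Finset.sum_eq_zero fun s' _ => ?_
    have := (Finset.sum_eq_zero_iff_of_nonneg fun s' _ => mul_nonneg (hT s s') (hq.1 s')).1 h s'
      (Finset.mem_univ s')
    rcases mul_eq_zero.1 this with h | h
    · rw [h, zero_mul]
    · rw [hac s' h, mul_zero]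
  have hac2 : ∀ s, ∑ s', U s s' * q s' = 0 → ∑ s', T s s' * q s' = 0 := fun s h =>
    le_antisymm (by simpa [h] using hTUq s) ((hmem hT hT1 hq).1 s)
  have h1 := klSum_kernel_le hT hT1 hκ hp.1 hq.1 (hp.2.trans hq.2.symm) hac
  rw [klSum_eq_sum_mul_log (hmem hT hT1 hp) (hmem hU hU1 hq) fun s h => hac1 s (hac2 s h)]
  rw [klSum_eq_sum_mul_log (hmem hT hT1 hp) (hmem hT hT1 hq) hac1] at h1
  have h2 : ∑ s, (∑ s', T s s' * p s') * c = c := by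
    rw [← Finset.sum_mul, (hmem hT hT1 hp).2, one_mul]
  -- Split log(Tp/Uq) = log(Tp/Tq) + log(Tq/Uq). The first part is the contracted divergence; the
  -- second is at most `c`, and Tp has mass one.
  refine le_trans ?_ (add_le_add h1 h2.le)
  rw [← Finset.sum_add_distrib]
  refine Finset.sum_le_sum fun s _ => ?_
  rw [← mul_add]
  rcases ((hmem hT hT1 hp).1 s).eq_or_lt with h0 | h0
  · simp only at h0
    rw [← h0, zero_mul, zero_mul]
  refine mul_le_mul_of_nonneg_left ?_ h0.le
  simp only at h0
  have hq0 : 0 < ∑ s', T s s' * q s' :=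
    lt_of_le_of_ne ((hmem hT hT1 hq).1 s) fun h => h0.ne' (hac1 s h.symm)
  have hu0 : 0 < ∑ s', U s s' * q s' :=
    lt_of_le_of_ne ((hmem hU hU1 hq).1 s) fun h => hq0.ne' (hac2 s h.symm)
  have h3 := Real.log_le_log hq0 (hTUq s)
  rw [Real.log_mul (Real.exp_ne_zero _) hu0.ne', Real.log_exp] at h3
  rw [Real.log_div h0.ne' hu0.ne', Real.log_div h0.ne' hq0.ne']
  linarith

namespace DecPOMDP

variable (M : DecPOMDP K S A O)

/-- The unnormalized local belief after the observation and the combination step. -/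
noncomputable def combineLik (N : Network K) (β : ℝ) (x : ∀ k, O k) (ηs : Fin K → S → ℝ)
    (k : Fin K) (s : S) : ℝ :=
  ∏ l, (M.lik l (x l) s ^ β * ηs l s) ^ N.weight l k

variable {M} {π : JointPolicy K S A} {N : Network K} {β : ℝ} {x : ∀ k, O k}
  {η : S → ℝ} {ηs : Fin K → S → ℝ}

theorem jointLik_pos (hx : ∀ l s, 0 < M.lik l (x l) s) (s : S) : 0 < M.jointLik x s :=
  Finset.prod_pos fun l _ => hx l s

theorem jointLik_nonneg (x : ∀ k, O k) (s : S) : 0 ≤ M.jointLik x s :=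
  Finset.prod_nonneg fun l _ => M.lik_nonneg l _ s

theorem combineLik_nonneg (h : SameSupport η ηs) (k : Fin K) (s : S) :
    0 ≤ M.combineLik N β x ηs k s :=
  Finset.prod_nonneg fun l _ => Real.rpow_nonneg
    (mul_nonneg (Real.rpow_nonneg (M.lik_nonneg _ _ _) _) ((h.local_mem l).1 s)) _

theorem combineLik_pos (h : SameSupport η ηs) (hx : ∀ l s, 0 < M.lik l (x l) s) (k : Fin K)
    {s : S} (hs : 0 < η s) : 0 < M.combineLik N β x ηs k s :=
  Finset.prod_pos fun l _ => Real.rpow_pos_of_pos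
    (mul_pos (Real.rpow_pos_of_pos (hx l s) _) (h.pos l hs)) _

/-- Since 0 ^ 0 = 1, a zero of the local priors survives the geometric mean only thanks to an agent
of nonzero weight; one exists because the column sums to one. -/
theorem combineLik_eq_zero (h : SameSupport η ηs) (k : Fin K) {s : S} (hs : η s = 0) :
    M.combineLik N β x ηs k s = 0 := by
  obtain ⟨l, hl, hlk⟩ := Finset.exists_ne_zero_of_sum_ne_zero
    ((N.weight_sum k).trans_ne one_ne_zero)
  refine Finset.prod_eq_zero hl ?_
  rw [(h.eq_zero_iff l s).2 hs, mul_zero, Real.zero_rpow hlk]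

theorem sum_combineLik_pos (h : SameSupport η ηs) (hx : ∀ l s, 0 < M.lik l (x l) s) (k : Fin K) :
    0 < ∑ s, M.combineLik N β x ηs k s := by
  obtain ⟨s, hs⟩ := exists_pos_of_mem_stdSimplex h.central
  exact Finset.sum_pos' (fun s _ => combineLik_nonneg h k s)
    ⟨s, Finset.mem_univ s, combineLik_pos h hx k hs⟩

theorem sum_jointLik_mul_pos (h : SameSupport η ηs) (hx : ∀ l s, 0 < M.lik l (x l) s) :
    0 < ∑ s, M.jointLik x s * η s := by
  obtain ⟨s, hs⟩ := exists_pos_of_mem_stdSimplex h.central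
  exact Finset.sum_pos' (fun s _ => mul_nonneg (jointLik_nonneg x s) (h.central.1 s))
    ⟨s, Finset.mem_univ s, mul_pos (jointLik_pos hx s) hs⟩

/-- The normalizers of the intermediate beliefs do not depend on the state and cancel. Agents
outside the neighbourhood have weight zero, so the product may run over all agents. -/
theorem combine_adapt_eq (h : SameSupport η ηs) (hx : ∀ l s, 0 < M.lik l (x l) s) (k : Fin K) :
    combine N (M.adapt β x ηs) k = rescale (M.combineLik N β x ηs k) := by
  have hf : ∀ l s, 0 ≤ M.lik l (x l) s ^ β * ηs l s := fun l s =>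
    mul_nonneg (Real.rpow_nonneg (M.lik_nonneg _ _ _) _) ((h.local_mem l).1 s)
  have hZ : ∀ l, 0 < ∑ s, M.lik l (x l) s ^ β * ηs l s := fun l => by
    obtain ⟨s, hs⟩ := exists_pos_of_mem_stdSimplex h.central
    exact Finset.sum_pos' (fun s _ => hf l s)
      ⟨s, Finset.mem_univ s, mul_pos (Real.rpow_pos_of_pos (hx l s) _) (h.pos l hs)⟩
  have hc : (∏ l, (∑ s, M.lik l (x l) s ^ β * ηs l s) ^ N.weight l k)⁻¹ ≠ 0 :=
    inv_ne_zero (Finset.prod_pos fun l _ => Real.rpow_pos_of_pos (hZ l) _).ne'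
  rw [← rescale_const_mul hc, combine]
  congr 1
  funext s
  rw [combineLik, mul_comm, ← div_eq_mul_inv, ← Finset.prod_div_distrib]
  have : ∏ l ∈ N.nbhd k, M.adapt β x ηs l s ^ N.weight l k
      = ∏ l, M.adapt β x ηs l s ^ N.weight l k := by
    refine Finset.prod_subset (Finset.subset_univ _) fun l _ hl => ?_
    rw [not_imp_comm.1 N.mem_nbhd_of_weight_ne_zero hl, Real.rpow_zero]
  rw [this]
  refine Finset.prod_congr rfl fun l _ => ?_
  rw [adapt, rescale, Real.div_rpow (hf l s) (hZ l).le]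

/-- With positive likelihoods an observation leaves all supports unchanged. -/
theorem _root_.SameSupport.update (h : SameSupport η ηs) (hx : ∀ l s, 0 < M.lik l (x l) s) :
    SameSupport (rescale fun s => M.jointLik x s * η s) (combine N (M.adapt β x ηs)) where
  central := rescale_mem_stdSimplex
    (fun s => mul_nonneg (jointLik_nonneg x s) (h.central.1 s)) (sum_jointLik_mul_pos h hx)
  local_mem k := by
    rw [combine_adapt_eq h hx]
    exact rescale_mem_stdSimplex (combineLik_nonneg h k) (sum_combineLik_pos h hx k)
  eq_zero_iff k s := by
    rw [combine_adapt_eq h hx, rescale, rescale, div_eq_zero_iff, div_eq_zero_iff,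
      or_iff_left (sum_combineLik_pos h hx k).ne', or_iff_left (sum_jointLik_mul_pos h hx).ne',
      mul_eq_zero, or_iff_right (jointLik_pos hx s).ne']
    refine ⟨fun h0 => ?_, fun h0 => combineLik_eq_zero h k h0⟩
    by_contra hne
    exact (combineLik_pos h hx k (lt_of_le_of_ne (h.central.1 s) (Ne.symm hne))).ne' h0

theorem _root_.SameSupport.predict {τ : ℝ} (hτ : M.HopBound π N τ) (h : SameSupport η ηs)
    (a : ∀ k, A k) :
    SameSupport (fun s => ∑ s', M.trans s s' a * η s')
      (fun k s => ∑ s', M.localTrans π (N.nbhd k) s s' a * ηs k s') where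
  central := by
    refine ⟨fun s => Finset.sum_nonneg fun s' _ =>
      mul_nonneg (M.trans_nonneg _ _ _) (h.central.1 s'), ?_⟩
    rw [Finset.sum_comm]
    simp only [← Finset.sum_mul, M.trans_sum, one_mul, h.central.2]
  local_mem k := by
    refine ⟨fun s => Finset.sum_nonneg fun s' _ =>
      mul_nonneg (M.localTrans_nonneg _ _ _ _ _) ((h.local_mem k).1 s'), ?_⟩
    rw [Finset.sum_comm]
    simp only [← Finset.sum_mul, M.sum_localTrans, one_mul, (h.local_mem k).2]
  eq_zero_iff k s := by
    rw [Finset.sum_eq_zero_iff_of_nonneg fun s' _ =>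
        mul_nonneg (M.localTrans_nonneg _ _ _ _ _) ((h.local_mem k).1 s'),
      Finset.sum_eq_zero_iff_of_nonneg fun s' _ =>
        mul_nonneg (M.trans_nonneg _ _ _) (h.central.1 s')]
    simp only [mul_eq_zero, hτ.localTrans_eq_zero_iff, h.eq_zero_iff]

theorem klSum_predict_le {τ κ : ℝ} (hτ : M.HopBound π N τ) (h : SameSupport η ηs)
    {a : ∀ k, A k} (hκ : M.dobrushin a ≤ κ) (k : Fin K) :
    klSum (fun s => ∑ s', M.trans s s' a * η s')
      (fun s => ∑ s', M.localTrans π (N.nbhd k) s s' a * ηs k s')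
      ≤ κ * klSum η (ηs k) + ((K : ℝ) - N.minDeg) * τ := by
  have : Nonempty S := (exists_pos_of_mem_stdSimplex h.central).nonempty
  exact klSum_kernel_le_add (fun s s' => M.trans_nonneg s s' a) (fun s' => M.trans_sum s' a)
    (fun s s' => M.localTrans_nonneg _ _ s s' a) (fun s' => M.sum_localTrans _ _ s' a)
    (M.le_of_dobrushin_le hκ) (fun s s' => hτ.trans_le k s s' a) h.central (h.local_mem k)
    fun s => (h.eq_zero_iff k s).1

/-- Pointwise form of the bound on the divergence after an update. -/
theorem sum_mul_klSum_update_le (h : SameSupport η ηs) (hx : ∀ l s, 0 < M.lik l (x l) s)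
    {B R : ℝ} (hB : ∀ l s, |Real.log (M.lik l (x l) s)| ≤ B) (k : Fin K)
    (hR : (∑ l, |1 - β * N.weight l k|) * B ≤ R) :
    (∑ s, M.jointLik x s * η s) * klSum (rescale fun s => M.jointLik x s * η s)
        (combine N (M.adapt β x ηs) k)
      ≤ ∑ s, (η s * (∑ l, N.weight l k * Real.log (η s / ηs l s)) + 2 * R * η s
          + ∏ l, ηs l s ^ N.weight l k - η s) * M.jointLik x s := by
  have hu := h.update (N := N) (β := β) hx
  set m := ∑ s, M.jointLik x s * η s with hm
  set W := M.combineLik N β x ηs k with hW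
  have hm0 : 0 < m := sum_jointLik_mul_pos h hx
  have hZ0 : 0 < ∑ s, W s := sum_combineLik_pos h hx k
  have hJ := fun s => jointLik_pos hx s
  set z : S → ℝ := fun s => ∏ l, ηs l s ^ N.weight l k with hz
  have hz0 : ∀ s, 0 ≤ z s := fun s =>
    Finset.prod_nonneg fun l _ => Real.rpow_nonneg ((h.local_mem l).1 s) _
  -- Two-sided bound on the effect of the exponents β c_{lk} differing from 1; both signs are
  -- needed, one for the numerator and one for the normalizer. Together they cost 2R.
  have habs : ∀ s, ∀ c : ℝ, (c = 1 ∨ c = -1) →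
      c * ∑ l, (1 - β * N.weight l k) * Real.log (M.lik l (x l) s) ≤ R := by
    intro s c hc
    refine le_trans ?_ hR
    rw [Finset.mul_sum, Finset.sum_mul]
    refine Finset.sum_le_sum fun l _ => ?_
    refine (le_abs_self _).trans ?_
    have hc1 : |c| = 1 := by rcases hc with rfl | rfl <;> simp
    rw [abs_mul, hc1, one_mul, abs_mul]
    exact mul_le_mul_of_nonneg_left (hB l s) (abs_nonneg _)
  have hWle : ∀ s, W s ≤ Real.exp R * (M.jointLik x s * z s) := by
    intro s
    have h1 : W s = (∏ l, M.lik l (x l) s ^ (β * N.weight l k)) * z s := by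
      rw [hW, combineLik, hz, ← Finset.prod_mul_distrib]
      refine Finset.prod_congr rfl fun l _ => ?_
      rw [Real.mul_rpow (Real.rpow_nonneg (hx l s).le _) ((h.local_mem l).1 s),
        Real.rpow_mul (hx l s).le]
    have h2 : ∏ l, M.lik l (x l) s ^ (β * N.weight l k) ≤ Real.exp R * M.jointLik x s := by
      have hp : 0 < ∏ l, M.lik l (x l) s ^ (β * N.weight l k) :=
        Finset.prod_pos fun l _ => Real.rpow_pos_of_pos (hx l s) _
      rw [← Real.log_le_log_iff hp (mul_pos (Real.exp_pos _) (hJ s)),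
        Real.log_mul (Real.exp_ne_zero _) (hJ s).ne', Real.log_exp, jointLik,
        Real.log_prod fun l _ => (Real.rpow_pos_of_pos (hx l s) _).ne',
        Real.log_prod fun l _ => (hx l s).ne']
      simp only [fun l => Real.log_rpow (hx l s) (β * N.weight l k)]
      have := habs s (-1) (Or.inr rfl)
      simp only [sub_mul, one_mul, Finset.sum_sub_distrib] at this
      linarith
    rw [h1, ← mul_assoc]
    exact mul_le_mul_of_nonneg_right h2 (hz0 s)
  have hZle : ∑ s, W s ≤ Real.exp R * ∑ s, M.jointLik x s * z s := by
    rw [Finset.mul_sum]; exact Finset.sum_le_sum fun s _ => hWle s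
  set Z' := ∑ s, M.jointLik x s * z s with hZ'
  have hZ'0 : 0 < Z' := pos_of_mul_pos_right (lt_of_lt_of_le hZ0 hZle) (Real.exp_pos R).le
  -- The linear bound log t ≤ t − 1 is used because its product with m is affine in the likelihoods,
  -- which can then be integrated out exactly.
  have hlogZ : Real.log (∑ s, W s) - Real.log m ≤ R + Z' / m - 1 := by
    have h1 := Real.log_le_log hZ0 hZle
    rw [Real.log_mul (Real.exp_ne_zero _) hZ'0.ne', Real.log_exp] at h1
    have h2 := Real.log_le_sub_one_of_pos (div_pos hZ'0 hm0)
    rw [Real.log_div hZ'0.ne' hm0.ne'] at h2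
    linarith
  have hterm : ∀ s, 0 < η s → Real.log (rescale (fun s => M.jointLik x s * η s) s /
      combine N (M.adapt β x ηs) k s)
        ≤ (∑ l, N.weight l k * Real.log (η s / ηs l s)) + 2 * R + Z' / m - 1 := by
    intro s hs
    have hW0 : 0 < W s := combineLik_pos h hx k hs
    rw [combine_adapt_eq h hx, ← hW, rescale, rescale, ← hm,
      Real.log_div (div_pos (mul_pos (hJ s) hs) hm0).ne' (div_pos hW0 hZ0).ne',
      Real.log_div (mul_pos (hJ s) hs).ne' hm0.ne', Real.log_div hW0.ne' hZ0.ne',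
      Real.log_mul (hJ s).ne' hs.ne']
    have h1 : Real.log (W s) = ∑ l, (β * N.weight l k * Real.log (M.lik l (x l) s)
        + N.weight l k * Real.log (ηs l s)) := by
      rw [hW, combineLik, Real.log_prod fun l _ => (Real.rpow_pos_of_pos
        (mul_pos (Real.rpow_pos_of_pos (hx l s) _) (h.pos l hs)) _).ne']
      refine Finset.sum_congr rfl fun l _ => ?_
      rw [Real.log_rpow (mul_pos (Real.rpow_pos_of_pos (hx l s) _) (h.pos l hs)),
        Real.log_mul (Real.rpow_pos_of_pos (hx l s) _).ne' (h.pos l hs).ne',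
        Real.log_rpow (hx l s)]
      ring
    have h2 : Real.log (M.jointLik x s) = ∑ l, Real.log (M.lik l (x l) s) :=
      Real.log_prod fun l _ => (hx l s).ne'
    have h3 : ∑ l, N.weight l k * Real.log (η s / ηs l s)
        = Real.log (η s) - ∑ l, N.weight l k * Real.log (ηs l s) := by
      simp only [fun l => Real.log_div hs.ne' (h.pos l hs).ne', mul_sub, Finset.sum_sub_distrib,
        ← Finset.sum_mul, N.weight_sum, one_mul]
    have h4 := habs s 1 (Or.inl rfl)
    simp only [sub_mul, one_mul, Finset.sum_sub_distrib] at h4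
    rw [h1, h2, h3, Finset.sum_add_distrib]
    linarith
  rw [klSum_eq_sum_mul_log hu.central (hu.local_mem k) fun s => (hu.eq_zero_iff k s).1,
    Finset.mul_sum]
  -- Summed against the density m, the term Z'/m becomes Z' = Σ L z; the right-hand side of the
  -- lemma is thus linear in the likelihoods.
  have hsum : ∑ s, (η s * (∑ l, N.weight l k * Real.log (η s / ηs l s)) + 2 * R * η s
        + z s - η s) * M.jointLik x s
      = ∑ s, M.jointLik x s * η s *
        ((∑ l, N.weight l k * Real.log (η s / ηs l s)) + 2 * R + Z' / m - 1) := by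
    have e1 : ∀ s, (η s * (∑ l, N.weight l k * Real.log (η s / ηs l s)) + 2 * R * η s
          + z s - η s) * M.jointLik x s
        = M.jointLik x s * η s * ((∑ l, N.weight l k * Real.log (η s / ηs l s)) + 2 * R - 1)
          + M.jointLik x s * z s := fun s => by ring
    have e2 : ∀ s, M.jointLik x s * η s *
          ((∑ l, N.weight l k * Real.log (η s / ηs l s)) + 2 * R + Z' / m - 1)
        = M.jointLik x s * η s * ((∑ l, N.weight l k * Real.log (η s / ηs l s)) + 2 * R - 1)
          + M.jointLik x s * η s * (Z' / m) := fun s => by ring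
    simp only [e1, e2, Finset.sum_add_distrib, ← Finset.sum_mul, ← hm, ← hZ']
    rw [mul_div_cancel₀ _ hm0.ne']
  rw [hsum]
  refine Finset.sum_le_sum fun s _ => ?_
  rw [← mul_assoc, sum_mul_rescale fun s => mul_nonneg (hJ s).le (h.central.1 s)]
  rcases (h.central.1 s).eq_or_lt with h0 | h0
  · simp [← h0]
  · exact mul_le_mul_of_nonneg_left (hterm s h0) (mul_pos (hJ s) h0).le

/-- Integrated form of the right-hand side of `sum_mul_klSum_update_le`. -/
theorem sum_update_bound_le (h : SameSupport η ηs) (R : ℝ) (k : Fin K) :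
    ∑ s, (η s * (∑ l, N.weight l k * Real.log (η s / ηs l s)) + 2 * R * η s
        + ∏ l, ηs l s ^ N.weight l k - η s)
      ≤ ∑ l, N.weight l k * klSum η (ηs l) + 2 * R := by
  -- A weighted geometric mean of probability vectors has mass at most one, so the terms z − η
  -- contribute nothing positive.
  have h1 : ∑ s, ∏ l, ηs l s ^ N.weight l k ≤ 1 := by
    calc ∑ s, ∏ l, ηs l s ^ N.weight l k ≤ ∑ s, ∑ l, N.weight l k * ηs l s :=
          Finset.sum_le_sum fun s _ => Real.geom_mean_le_arith_mean_weighted _ _ _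
            (fun l _ => N.weight_nonneg l k) (N.weight_sum k) fun l _ => (h.local_mem l).1 s
      _ = 1 := by
          rw [Finset.sum_comm]
          simp only [← Finset.mul_sum, (h.local_mem _).2, mul_one, N.weight_sum]
  have h2 : ∑ s, η s * (∑ l, N.weight l k * Real.log (η s / ηs l s))
      = ∑ l, N.weight l k * klSum η (ηs l) := by
    simp only [fun l => klSum_eq_sum_mul_log h.central (h.local_mem l)
      fun s => (h.eq_zero_iff l s).1, Finset.mul_sum]
    rw [Finset.sum_comm]
    exact Finset.sum_congr rfl fun l _ => Finset.sum_congr rfl fun s _ => by ring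
  simp only [Finset.sum_sub_distrib, Finset.sum_add_distrib, ← Finset.mul_sum, h2, h.central.2]
  linarith

end DecPOMDP

end Pathwise

/-! ### The measure-theoretic divergence of beliefs as a finite sum. -/

section BeliefDivergence

variable {S : Type*} [Fintype S] [MeasurableSpace S] [MeasurableSingletonClass S]

theorem lintegral_vecMeasure (p : S → ℝ) (f : S → ℝ≥0∞) :
    ∫⁻ s, f s ∂(vecMeasure p) = ∑ s, ENNReal.ofReal (p s) * f s := by
  rw [vecMeasure, lintegral_finsetSum_measure]
  simp [lintegral_smul_measure, lintegral_dirac]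

instance (p : S → ℝ) : IsFiniteMeasure (vecMeasure p) := by
  refine ⟨?_⟩
  rw [← lintegral_one, lintegral_vecMeasure]
  simp [ENNReal.sum_lt_top]

/-- The measure of p has density p/q with respect to that of q, where division by zero is harmless
because p vanishes with q. -/
theorem beliefKL_eq {p q : S → ℝ} (hp : ∀ s, 0 ≤ p s) (hq : ∀ s, 0 ≤ q s)
    (hac : ∀ s, q s = 0 → p s = 0) : beliefKL p q = ENNReal.ofReal (klSum p q) := by
  have hd : vecMeasure p = (vecMeasure q).withDensity fun s => ENNReal.ofReal (p s / q s) := by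
    ext t ht
    rw [withDensity_apply _ ht, ← lintegral_indicator ht, ← lintegral_indicator_one ht,
      lintegral_vecMeasure, lintegral_vecMeasure]
    refine Finset.sum_congr rfl fun s _ => ?_
    by_cases hs : s ∈ t
    · rw [Set.indicator_of_mem hs, Set.indicator_of_mem hs, ← ENNReal.ofReal_mul (hq s)]
      by_cases h0 : q s = 0
      · simp [h0, hac s h0]
      · simp [mul_div_cancel₀ _ h0]
    · simp [hs]
  have hr := Measure.rnDeriv_withDensity (vecMeasure q)
    (f := fun s => ENNReal.ofReal (p s / q s)) (Measurable.of_discrete)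
  rw [← hd] at hr
  rw [beliefKL, klDiv_eq_lintegral_klFun_of_ac (hd ▸ withDensity_absolutelyContinuous _ _),
    lintegral_congr_ae (hr.mono fun s hs => by rw [hs]), lintegral_vecMeasure, klSum,
    ENNReal.ofReal_sum_of_nonneg fun s _ =>
      mul_nonneg (hq s) (klFun_nonneg (div_nonneg (hp s) (hq s)))]
  refine Finset.sum_congr rfl fun s _ => ?_
  rw [ENNReal.ofReal_mul (hq s), ENNReal.toReal_ofReal (div_nonneg (hp s) (hq s))]

end BeliefDivergence

/-! ### Likelihoods as densities, and the update bound averaged over the observation. -/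

section Observations

variable {K : ℕ} {S : Type*} {A O : Fin K → Type*} [Fintype S] [∀ k, Fintype (A k)]
  [∀ k, MeasurableSpace (O k)]

section Measurability

variable {Ω : Type*} [MeasurableSpace Ω]

theorem measurable_rescale {f : Ω → S → ℝ} (hf : ∀ s, Measurable fun ω => f ω s) (s : S) :
    Measurable fun ω => rescale (f ω) s := by
  unfold rescale
  fun_prop

theorem measurable_klSum {p q : Ω → S → ℝ} (hp : ∀ s, Measurable fun ω => p ω s)
    (hq : ∀ s, Measurable fun ω => q ω s) : Measurable fun ω => klSum (p ω) (q ω) := by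
  unfold klSum
  exact Finset.measurable_sum _ fun s _ =>
    (hq s).mul (measurable_klFun.comp ((hp s).div (hq s)))

namespace DecPOMDP

variable (M : DecPOMDP K S A O)

theorem measurable_lik {x : Ω → ∀ k, O k} (hx : Measurable x) (l : Fin K) (s : S) :
    Measurable fun ω => M.lik l (x ω l) s :=
  (M.lik_measurable l s).comp ((measurable_pi_apply l).comp hx)

theorem measurable_jointLik {x : Ω → ∀ k, O k} (hx : Measurable x) (s : S) :
    Measurable fun ω => M.jointLik (x ω) s :=
  Finset.measurable_prod _ fun l _ => M.measurable_lik hx l s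

theorem measurable_central_update {x : Ω → ∀ k, O k} (hx : Measurable x) {η : Ω → S → ℝ}
    (hη : ∀ s, Measurable fun ω => η ω s) (s : S) :
    Measurable fun ω => rescale (fun t => M.jointLik (x ω) t * η ω t) s :=
  measurable_rescale (fun t => (M.measurable_jointLik hx t).mul (hη t)) s

theorem measurable_combine_adapt (N : Network K) (β : ℝ) {x : Ω → ∀ k, O k} (hx : Measurable x)
    {ηs : Ω → Fin K → S → ℝ} (hη : ∀ l s, Measurable fun ω => ηs ω l s) (k : Fin K) (s : S) :
    Measurable fun ω => combine N (M.adapt β (x ω) (ηs ω)) k s := by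
  refine measurable_rescale (fun t => Finset.measurable_prod _ fun l _ => ?_) s
  refine Measurable.pow_const ?_ _
  exact measurable_rescale (fun u => ((M.measurable_lik hx l u).pow_const β).mul (hη l u)) t

end DecPOMDP

end Measurability

namespace DecPOMDP

variable (M : DecPOMDP K S A O)

instance (k : Fin K) : SigmaFinite (M.ref k) := M.ref_sigmaFinite k

theorem integrable_lik (k : Fin K) (s : S) : Integrable (fun ξ => M.lik k ξ s) (M.ref k) := by
  refine ⟨(M.lik_measurable k s).aestronglyMeasurable, ?_⟩
  rw [hasFiniteIntegral_iff_ofReal (ae_of_all _ fun ξ => M.lik_nonneg k ξ s), M.lik_mass]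
  exact ENNReal.one_lt_top

theorem integral_lik (k : Fin K) (s : S) : ∫ ξ, M.lik k ξ s ∂(M.ref k) = 1 := by
  rw [integral_eq_lintegral_of_nonneg_ae (ae_of_all _ fun ξ => M.lik_nonneg k ξ s)
    (M.lik_measurable k s).aestronglyMeasurable, M.lik_mass, ENNReal.toReal_one]

instance (k : Fin K) (s : S) : IsProbabilityMeasure (M.obsLaw k s) :=
  ⟨by rw [obsLaw, withDensity_apply _ MeasurableSet.univ, Measure.restrict_univ, M.lik_mass]⟩

instance (s : S) : IsProbabilityMeasure (M.jointObsLaw s) := by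
  unfold jointObsLaw; infer_instance

theorem integrable_jointLik (s : S) :
    Integrable (fun ξ => M.jointLik ξ s) (Measure.pi M.ref) :=
  Integrable.fintype_prod_dep fun k => M.integrable_lik k s

theorem integral_jointLik (s : S) : ∫ ξ, M.jointLik ξ s ∂(Measure.pi M.ref) = 1 := by
  have := integral_fintype_prod_eq_prod (μ := M.ref) fun k ξ => M.lik k ξ s
  simp only [M.integral_lik, Finset.prod_const_one] at this
  exact this

theorem jointObsLaw_eq_withDensity (s : S) : M.jointObsLaw s =
    (Measure.pi M.ref).withDensity fun ξ => ENNReal.ofReal (M.jointLik ξ s) := by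
  refine Measure.pi_eq fun t ht => ?_
  have hind : ∀ ξ, (Set.univ.pi t).indicator (fun ξ => M.jointLik ξ s) ξ
      = ∏ k, (t k).indicator (fun ξ => M.lik k ξ s) (ξ k) := by
    intro ξ
    by_cases h : ξ ∈ Set.univ.pi t
    · rw [Set.indicator_of_mem h]
      exact Finset.prod_congr rfl fun k _ => by rw [Set.indicator_of_mem (h k trivial)]
    · rw [Set.indicator_of_notMem h]
      simp only [Set.mem_pi, Set.mem_univ, true_imp_iff, not_forall] at h
      obtain ⟨k, hk⟩ := h
      exact (Finset.prod_eq_zero (Finset.mem_univ k) (Set.indicator_of_notMem hk _)).symm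
  have hm := MeasurableSet.univ_pi ht
  rw [withDensity_apply _ hm, ← ofReal_integral_eq_lintegral_ofReal
    (M.integrable_jointLik s).integrableOn (ae_of_all _ fun ξ => jointLik_nonneg ξ s),
    ← integral_indicator hm]
  simp only [hind]
  rw [integral_fintype_prod_eq_prod (μ := M.ref) fun k => (t k).indicator fun ξ => M.lik k ξ s,
    ENNReal.ofReal_prod_of_nonneg fun k _ => integral_nonneg fun ξ =>
      Set.indicator_nonneg (fun ξ _ => M.lik_nonneg k ξ s) ξ]
  refine Finset.prod_congr rfl fun k _ => ?_
  rw [integral_indicator (ht k), ofReal_integral_eq_lintegral_ofReal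
    (M.integrable_lik k s).integrableOn (ae_of_all _ fun ξ => M.lik_nonneg k ξ s), obsLaw,
    withDensity_apply _ (ht k)]

theorem lintegral_jointObsLaw (s : S) {f : (∀ k, O k) → ℝ≥0∞} (hf : Measurable f) :
    ∫⁻ ξ, f ξ ∂(M.jointObsLaw s)
      = ∫⁻ ξ, ENNReal.ofReal (M.jointLik ξ s) * f ξ ∂(Measure.pi M.ref) := by
  have hL : Measurable fun ξ => M.jointLik ξ s := M.measurable_jointLik measurable_id s
  rw [jointObsLaw_eq_withDensity, lintegral_withDensity_eq_lintegral_mul _ hL.ennreal_ofReal hf]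
  rfl

variable {M} {B : ℝ}

/-- A finite divergence forces absolute continuity. Hence what holds almost surely in state s' also
holds in the true state s, and no observation ever rules out a state. -/
theorem BoundedLik.ae_jointObsLaw (hB : M.BoundedLik B) (s : S) :
    ∀ᵐ ξ ∂(M.jointObsLaw s), ∀ l s', 0 < M.lik l (ξ l) s' ∧ |Real.log (M.lik l (ξ l) s')| ≤ B := by
  rw [ae_all_iff]; intro l
  rw [ae_all_iff]; intro s'
  have h1 : ∀ᵐ ξ ∂(M.obsLaw l s'), 0 < M.lik l ξ s' ∧ |Real.log (M.lik l ξ s')| ≤ B := by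
    rw [obsLaw, ae_withDensity_iff (M.lik_measurable l s').ennreal_ofReal]
    filter_upwards [hB.log_le l s'] with ξ hξ h
    have : 0 < M.lik l ξ s' := by
      rwa [ne_eq, ENNReal.ofReal_eq_zero, not_le] at h
    exact ⟨this, hξ this.ne'⟩
  have h2 : ∀ᵐ ξ ∂(M.obsLaw l s), 0 < M.lik l ξ s' ∧ |Real.log (M.lik l ξ s')| ≤ B :=
    (klDiv_ne_top_iff.1 (hB.kl_finite l s s')).1.ae_le h1
  exact (Measure.quasiMeasurePreserving_eval (fun k => M.obsLaw k s) l).ae h2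

/-- The same fact seen from the reference measure: outside a null set, an observation has either
zero joint likelihood in every state or positive, bounded likelihoods throughout. -/
theorem BoundedLik.ae_ref (hB : M.BoundedLik B) :
    ∀ᵐ ξ ∂(Measure.pi M.ref), (∀ s, M.jointLik ξ s = 0) ∨
      ∀ l s, 0 < M.lik l (ξ l) s ∧ |Real.log (M.lik l (ξ l) s)| ≤ B := by
  have h : ∀ s, ∀ᵐ ξ ∂(Measure.pi M.ref), ENNReal.ofReal (M.jointLik ξ s) ≠ 0 →
      ∀ l s', 0 < M.lik l (ξ l) s' ∧ |Real.log (M.lik l (ξ l) s')| ≤ B := by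
    intro s
    have := hB.ae_jointObsLaw s
    have hL : Measurable fun ξ => M.jointLik ξ s := M.measurable_jointLik measurable_id s
    rwa [jointObsLaw_eq_withDensity, ae_withDensity_iff hL.ennreal_ofReal] at this
  filter_upwards [ae_all_iff.2 h] with ξ hξ
  by_cases h0 : ∀ s, M.jointLik ξ s = 0
  · exact Or.inl h0
  · push Not at h0
    obtain ⟨s, hs⟩ := h0
    refine Or.inr (hξ s ?_)
    rw [ne_eq, ENNReal.ofReal_eq_zero, not_le]
    exact lt_of_le_of_ne (jointLik_nonneg ξ s) hs.symm

/-- The bound on the expected divergence after an update, for an observation drawn from the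
predictive distribution of the central belief. -/
theorem sum_lintegral_klSum_update_le {N : Network K} {β : ℝ} (hB : M.BoundedLik B)
    {η : S → ℝ} {ηs : Fin K → S → ℝ} (h : SameSupport η ηs) (k : Fin K) {R : ℝ}
    (hR : (∑ l, |1 - β * N.weight l k|) * B ≤ R) :
    ∑ s, ENNReal.ofReal (η s) * ∫⁻ ξ, ENNReal.ofReal (klSum
        (rescale fun t => M.jointLik ξ t * η t) (combine N (M.adapt β ξ ηs) k)) ∂(M.jointObsLaw s)
      ≤ ENNReal.ofReal (∑ l, N.weight l k * klSum η (ηs l) + 2 * R) := by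
  set D : (∀ k, O k) → ℝ := fun ξ => klSum
    (rescale fun t => M.jointLik ξ t * η t) (combine N (M.adapt β ξ ηs) k) with hD
  have hDm : Measurable D := measurable_klSum
    (M.measurable_central_update (x := fun ξ => ξ) (η := fun _ => η) measurable_id
      fun s => measurable_const)
    (M.measurable_combine_adapt N β (x := fun ξ => ξ) (ηs := fun _ => ηs) measurable_id
      (fun l s => measurable_const) k)
  set w : S → ℝ := fun s => η s * (∑ l, N.weight l k * Real.log (η s / ηs l s)) + 2 * R * η s
          + ∏ l, ηs l s ^ N.weight l k - η s with hw
  have hL : ∀ s, Measurable fun ξ => M.jointLik ξ s := M.measurable_jointLik measurable_id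
  have hLD : ∀ s, Measurable fun ξ =>
      ENNReal.ofReal (M.jointLik ξ s) * ENNReal.ofReal (D ξ) :=
    fun s => (hL s).ennreal_ofReal.mul hDm.ennreal_ofReal
  have hint : ∀ s, Integrable (fun ξ => w s * M.jointLik ξ s) (Measure.pi M.ref) :=
    fun s => (M.integrable_jointLik s).const_mul _
  -- The coefficients `w` may be negative. Nonnegativity of the whole sum, needed to pass between
  -- the two kinds of integral, comes from its lying above m times a divergence.
  have hae : ∀ᵐ ξ ∂(Measure.pi M.ref), (0 ≤ ∑ s, w s * M.jointLik ξ s) ∧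
      ∑ s, ENNReal.ofReal (η s) * (ENNReal.ofReal (M.jointLik ξ s) * ENNReal.ofReal (D ξ))
        ≤ ENNReal.ofReal (∑ s, w s * M.jointLik ξ s) := by
    filter_upwards [hB.ae_ref] with ξ hξ
    rcases hξ with h0 | hpos
    · simp [h0]
    · have h1 := sum_mul_klSum_update_le h (fun l s => (hpos l s).1) (fun l s => (hpos l s).2) k hR
      have hu := h.update (N := N) (β := β) fun l s => (hpos l s).1
      have hD0 : 0 ≤ D ξ := klSum_nonneg hu.central.1 (hu.local_mem k).1
      have hm0 : ∀ s, 0 ≤ M.jointLik ξ s * η s := fun s =>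
        mul_nonneg (jointLik_nonneg ξ s) (h.central.1 s)
      refine ⟨le_trans (mul_nonneg (Finset.sum_nonneg fun s _ => hm0 s) hD0) h1, ?_⟩
      refine le_trans (le_of_eq ?_) (ENNReal.ofReal_le_ofReal h1)
      rw [Finset.sum_mul, ENNReal.ofReal_sum_of_nonneg fun s _ => mul_nonneg (hm0 s) hD0]
      refine Finset.sum_congr rfl fun s _ => ?_
      rw [← ENNReal.ofReal_mul (jointLik_nonneg ξ s), ← ENNReal.ofReal_mul (h.central.1 s)]
      congr 1
      ring
  calc ∑ s, ENNReal.ofReal (η s) * ∫⁻ ξ, ENNReal.ofReal (D ξ) ∂(M.jointObsLaw s)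
      = ∫⁻ ξ, ∑ s, ENNReal.ofReal (η s) *
          (ENNReal.ofReal (M.jointLik ξ s) * ENNReal.ofReal (D ξ)) ∂(Measure.pi M.ref) := by
        rw [lintegral_finsetSum _ fun s _ => (hLD s).const_mul _]
        refine Finset.sum_congr rfl fun s _ => ?_
        rw [lintegral_const_mul _ (hLD s), M.lintegral_jointObsLaw s hDm.ennreal_ofReal]
    _ ≤ ∫⁻ ξ, ENNReal.ofReal (∑ s, w s * M.jointLik ξ s) ∂(Measure.pi M.ref) :=
        lintegral_mono_ae (hae.mono fun ξ hξ => hξ.2)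
    _ = ENNReal.ofReal (∑ s, w s) := by
        rw [← ofReal_integral_eq_lintegral_ofReal (integrable_finsetSum _ fun s _ => hint s)
          (hae.mono fun ξ hξ => hξ.1), integral_finsetSum _ fun s _ => hint s]
        simp only [integral_const_mul, M.integral_jointLik, mul_one]
    _ ≤ _ := ENNReal.ofReal_le_ofReal (sum_update_bound_le h R k)

end DecPOMDP

end Observations

/-! ### Conditional probabilities with extended nonnegative integrands. -/

section ConditionalProbability

theorem lintegral_eq_sum_fiber {Ω : Type*} [MeasurableSpace Ω] {P : Measure Ω} {ι : Type*} [Fintype ι] [MeasurableSpace ι]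
    [MeasurableSingletonClass ι] {Z : Ω → ι} (hZ : Measurable Z) (g : Ω → ℝ≥0∞) :
    ∫⁻ ω, g ω ∂P = ∑ z, ∫⁻ ω in Z ⁻¹' {z}, g ω ∂P := by
  have hu : (⋃ z ∈ (Finset.univ : Finset ι), Z ⁻¹' {z}) = Set.univ := by
    ext ω; simp
  rw [← lintegral_biUnion_finset (fun z _ z' _ h => ?_)
    (fun z _ => hZ (measurableSet_singleton z)), hu, Measure.restrict_univ]
  exact Disjoint.preimage Z (Set.disjoint_singleton.2 h)

variable {Ω : Type*} {m m₁ m₂ m0 : MeasurableSpace Ω} {P : Measure Ω} [IsProbabilityMeasure P]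

theorem ofReal_setIntegral_condProb (hm : m ≤ m0) {A : Set Ω}
    (hA : MeasurableSet A) {r : Ω → ℝ} (hr : P⟦A | m⟧ =ᵐ[P] r) {E : Set Ω}
    (hE : MeasurableSet[m] E) : ∫⁻ ω in E, ENNReal.ofReal (r ω) ∂P = P (A ∩ E) := by
  have hAi : Integrable (A.indicator fun _ => (1 : ℝ)) P := (integrable_const 1).indicator hA
  have hr0 : ∀ᵐ ω ∂P, 0 ≤ r ω := by
    have := condExp_nonneg (m := m) (μ := P) (f := A.indicator fun _ => (1 : ℝ))
      (ae_of_all _ fun ω => Set.indicator_nonneg (fun _ _ => zero_le_one) ω)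
    filter_upwards [this, hr] with ω h1 h2
    rw [← h2]; exact h1
  rw [← ofReal_integral_eq_lintegral_ofReal ((integrable_condExp.congr hr).integrableOn)
    (ae_restrict_of_ae hr0), ← setIntegral_congr_ae₀ (hm E hE).nullMeasurableSet
      (hr.mono fun ω h _ => h), setIntegral_condExp hm hAi hE,
    integral_indicator hA, Measure.restrict_restrict hA]
  simp

/-- If `r` is the conditional probability of `A` given `m`, then integrating an `m`-measurable
function over `A` amounts to integrating it against `r`. -/
theorem setLIntegral_eq_lintegral_condProb_mul (hm : m ≤ m0) {A : Set Ω}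
    (hA : MeasurableSet A) {r : Ω → ℝ} (hr : P⟦A | m⟧ =ᵐ[P] r) {g : Ω → ℝ≥0∞}
    (hg : Measurable[m] g) : ∫⁻ ω in A, g ω ∂P = ∫⁻ ω, ENNReal.ofReal (r ω) * g ω ∂P := by
  have hq : Measurable[m] fun ω => ENNReal.ofReal ((P⟦A | m⟧) ω) :=
    stronglyMeasurable_condExp.measurable.ennreal_ofReal
  -- Seen on the smaller σ-algebra, the restriction of P to `A` has the conditional probability as
  -- its density.
  have hmeas : (P.restrict A).trim hm
      = (P.trim hm).withDensity fun ω => ENNReal.ofReal ((P⟦A | m⟧) ω) := by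
    refine @Measure.ext Ω m _ _ fun E hE => ?_
    rw [withDensity_apply _ hE, trim_measurableSet_eq hm hE, Measure.restrict_apply (hm E hE),
      restrict_trim hm _ hE, lintegral_trim hm hq,
      ofReal_setIntegral_condProb hm hA ae_eq_rfl hE, Set.inter_comm]
  have h1 : ∫⁻ ω in A, g ω ∂P = ∫⁻ ω, g ω ∂((P.restrict A).trim hm) := (lintegral_trim hm hg).symm
  rw [h1, hmeas, lintegral_withDensity_eq_lintegral_mul _ hq hg, lintegral_trim hm (hq.mul hg)]
  exact lintegral_congr_ae (hr.mono fun ω h => by simp only [Pi.mul_apply, h])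

/-- A function is the conditional probability given a supremum of two `σ`-algebras if it has the
right integrals over intersections. -/
theorem condProb_sup_eq (hm₁ : m₁ ≤ m0) (hm₂ : m₂ ≤ m0) {A : Set Ω}
    (hA : MeasurableSet A) {r : Ω → ℝ} (hr : Measurable[m₁ ⊔ m₂] r) (hr0 : ∀ ω, 0 ≤ r ω)
    (hr1 : ∀ᵐ ω ∂P, r ω ≤ 1)
    (h : ∀ E F, MeasurableSet[m₁] E → MeasurableSet[m₂] F →
      P (A ∩ (E ∩ F)) = ∫⁻ ω in E ∩ F, ENNReal.ofReal (r ω) ∂P) :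
    P⟦A | m₁ ⊔ m₂⟧ =ᵐ[P] r := by
  have hm : m₁ ⊔ m₂ ≤ m0 := sup_le hm₁ hm₂
  have hri : Integrable r P := by
    refine Integrable.of_bound (hr.mono hm le_rfl).aestronglyMeasurable 1 ?_
    filter_upwards [hr1] with ω h1
    rwa [Real.norm_eq_abs, abs_of_nonneg (hr0 ω)]
  have hfin : IsFiniteMeasure (P.withDensity fun ω => ENNReal.ofReal (r ω)) :=
    isFiniteMeasure_withDensity_ofReal hri.2
  -- The intersections E ∩ F form a π-system generating the supremum, so two finite measures that
  -- agree on them are equal.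
  have hgen : m₁ ⊔ m₂ = MeasurableSpace.generateFrom
      {G | ∃ E F, MeasurableSet[m₁] E ∧ MeasurableSet[m₂] F ∧ G = E ∩ F} := by
    refine le_antisymm (sup_le (fun E hE => ?_) fun F hF => ?_)
      (MeasurableSpace.generateFrom_le ?_)
    · exact MeasurableSpace.measurableSet_generateFrom
        ⟨E, Set.univ, hE, MeasurableSet.univ, (Set.inter_univ E).symm⟩
    · exact MeasurableSpace.measurableSet_generateFrom
        ⟨Set.univ, F, MeasurableSet.univ, hF, (Set.univ_inter F).symm⟩
    · rintro G ⟨E, F, hE, hF, rfl⟩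
      exact MeasurableSet.inter ((le_sup_left : m₁ ≤ m₁ ⊔ m₂) E hE)
        ((le_sup_right : m₂ ≤ m₁ ⊔ m₂) F hF)
  have hpi : IsPiSystem {G | ∃ E F, MeasurableSet[m₁] E ∧ MeasurableSet[m₂] F ∧ G = E ∩ F} := by
    rintro _ ⟨E, F, hE, hF, rfl⟩ _ ⟨E', F', hE', hF', rfl⟩ -
    exact ⟨E ∩ E', F ∩ F', hE.inter hE', hF.inter hF', Set.inter_inter_inter_comm E F E' F'⟩
  have hEF : ∀ E F, MeasurableSet[m₁] E → MeasurableSet[m₂] F →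
      (P.restrict A).trim hm (E ∩ F)
        = (P.withDensity fun ω => ENNReal.ofReal (r ω)).trim hm (E ∩ F) := by
    intro E F hE hF
    have hG : MeasurableSet[m₁ ⊔ m₂] (E ∩ F) :=
      MeasurableSet.inter ((le_sup_left : m₁ ≤ m₁ ⊔ m₂) E hE)
        ((le_sup_right : m₂ ≤ m₁ ⊔ m₂) F hF)
    rw [trim_measurableSet_eq hm hG, trim_measurableSet_eq hm hG,
      Measure.restrict_apply (hm _ hG), withDensity_apply _ (hm _ hG), Set.inter_comm, h E F hE hF]
  have hmeas : (P.restrict A).trim hm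
      = (P.withDensity fun ω => ENNReal.ofReal (r ω)).trim hm := by
    refine @ext_of_generate_finite Ω (m₁ ⊔ m₂) _ _ _ hgen hpi _ ?_ ?_
    · rintro _ ⟨E, F, hE, hF, rfl⟩
      exact hEF E F hE hF
    · have := hEF Set.univ Set.univ MeasurableSet.univ MeasurableSet.univ
      rwa [Set.inter_univ] at this
  refine (ae_eq_condExp_of_forall_setIntegral_eq hm ((integrable_const (1 : ℝ)).indicator hA)
    (fun _ _ _ => hri.integrableOn) (fun G hG _ => ?_)
    hr.stronglyMeasurable.aestronglyMeasurable).symm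
  have hG' := congrArg (fun μ => μ G) hmeas
  simp only [trim_measurableSet_eq hm hG, Measure.restrict_apply (hm _ hG),
    withDensity_apply _ (hm _ hG)] at hG'
  rw [integral_indicator hA, Measure.restrict_restrict hA,
    integral_eq_lintegral_of_nonneg_ae (ae_of_all _ hr0)
      (hr.mono hm le_rfl).aestronglyMeasurable, ← hG', Set.inter_comm]
  simp [measureReal_def]

/-- If, on an `m`-measurable event, `X` has conditional law `Λ` given `m`, then on this event
`X` can be integrated out with the `m`-measurable quantities frozen. -/
theorem setLIntegral_freeze (hm : m ≤ m0) {E F : Type*} [MeasurableSpace E]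
    [MeasurableSpace F] {X : Ω → E} (hX : Measurable X) {Y : Ω → F} (hY : Measurable[m] Y)
    {D : Set Ω} (hD : MeasurableSet[m] D) {Λ : Measure E} [IsProbabilityMeasure Λ]
    (h : ∀ t, MeasurableSet t → ∃ r, P⟦X ⁻¹' t | m⟧ =ᵐ[P] r ∧ ∀ ω ∈ D, r ω = Λ.real t)
    {f : F × E → ℝ≥0∞} (hf : Measurable f) :
    ∫⁻ ω in D, f (Y ω, X ω) ∂P = ∫⁻ ω in D, ∫⁻ x, f (Y ω, x) ∂Λ ∂P := by
  have hY0 : Measurable Y := hY.mono hm le_rfl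
  -- On `D` the conditional law of `X` is constant, so the joint law of `Y` and `X` is a product and
  -- Tonelli applies.
  have hlaw : ((P.restrict D).map Y).prod Λ = (P.restrict D).map fun ω => (Y ω, X ω) := by
    refine Measure.prod_eq fun s t hs ht => ?_
    obtain ⟨r, hr, hrD⟩ := h t ht
    have hsD : MeasurableSet[m] (Y ⁻¹' s ∩ D) := (hY hs).inter hD
    rw [Measure.map_apply (hY0.prodMk hX) (hs.prod ht), Measure.map_apply hY0 hs,
      Measure.restrict_apply (hY0 hs),
      Measure.restrict_apply ((hY0.prodMk hX) (hs.prod ht))]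
    have hset : (fun ω => (Y ω, X ω)) ⁻¹' s ×ˢ t ∩ D = X ⁻¹' t ∩ (Y ⁻¹' s ∩ D) := by
      ext ω; simp only [Set.mem_inter_iff, Set.mem_preimage, Set.mem_prod]; tauto
    rw [hset, ← ofReal_setIntegral_condProb hm (hX ht) hr hsD,
      setLIntegral_congr_fun (g := fun _ => Λ t) (hm _ hsD) fun ω hω => ?_, setLIntegral_const,
      mul_comm]
    simp only [hrD ω hω.2, measureReal_def]
    exact ENNReal.ofReal_toReal (measure_ne_top _ _)
  rw [← lintegral_map hf (hY0.prodMk hX), ← hlaw, lintegral_prod _ hf.aemeasurable,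
    lintegral_map hf.lintegral_prod_right' hY0]

end ConditionalProbability

/-! ### The σ-algebras generated by the past. -/

section History

variable {Ω E : Type*} [MeasurableSpace E] {X : ℕ → Ω → E}

theorem measurable_sigmaBefore {j n : ℕ} (h : j < n) : Measurable[sigmaBefore X n] (X j) := by
  rw [measurable_iff_comap_le]
  exact le_iSup₂_of_le (f := fun j (_ : j < n) =>
    MeasurableSpace.comap (X j) inferInstance) j h le_rfl

theorem sigmaBefore_mono {i j : ℕ} (h : i ≤ j) : sigmaBefore X i ≤ sigmaBefore X j :=
  iSup₂_le fun _ hk => (measurable_sigmaBefore (hk.trans_le h)).comap_le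

theorem sigmaBefore_succ (n : ℕ) :
    sigmaBefore X (n + 1) = sigmaBefore X n ⊔ MeasurableSpace.comap (X n) inferInstance := by
  refine le_antisymm (iSup₂_le fun j hj => ?_)
    (sup_le (sigmaBefore_mono n.le_succ) (measurable_sigmaBefore n.lt_succ_self).comap_le)
  rcases Nat.lt_succ_iff_lt_or_eq.1 hj with h | rfl
  · exact (measurable_sigmaBefore h).comap_le.trans le_sup_left
  · exact le_sup_right

theorem sigmaBefore_zero : sigmaBefore X 0 = ⊥ := by simp [sigmaBefore]

theorem sigmaBefore_le {m0 : MeasurableSpace Ω} (h : ∀ i, Measurable (X i)) (n : ℕ) :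
    sigmaBefore X n ≤ m0 :=
  iSup₂_le fun j _ => (h j).comap_le

end History

/-! ### Measurability of the beliefs, and Bayes' rule for the observation. -/

section DiffusionProcess

variable {K : ℕ} {S : Type*} {A O : Fin K → Type*} [Fintype S]
  [∀ k, Fintype (A k)] [∀ k, MeasurableSpace (A k)] [∀ k, MeasurableSingletonClass (A k)]
  [∀ k, MeasurableSpace (O k)]
  {M : DecPOMDP K S A O} {π : JointPolicy K S A} {N : Network K} {β : ℝ}
  {ηcen : S → ℝ} {ηloc : Fin K → S → ℝ}

namespace DecPOMDP

section Measurability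

variable {Ω : Type*} {m : MeasurableSpace Ω} {ξ : ℕ → Ω → ∀ k, O k} {a : ℕ → Ω → ∀ k, A k}

theorem measurable_centralPrior {i : ℕ} (hξ : ∀ j < i, Measurable (ξ j))
    (ha : ∀ j < i, Measurable (a j)) (x : S) :
    Measurable fun ω => M.centralPrior ηcen (fun j => ξ j ω) (fun j => a j ω) i x := by
  induction i generalizing x with
  | zero => exact measurable_const
  | succ i ih =>
    refine Finset.measurable_sum _ fun s' _ => Measurable.mul ?_ ?_
    · exact (Measurable.of_discrete (f := fun u => M.trans x s' u)).comp (ha i i.lt_succ_self)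
    · exact M.measurable_central_update (hξ i i.lt_succ_self)
        (fun t => ih (fun j hj => hξ j (hj.trans i.lt_succ_self))
          (fun j hj => ha j (hj.trans i.lt_succ_self)) t) s'

theorem measurable_localPrior {i : ℕ} (hξ : ∀ j < i, Measurable (ξ j))
    (ha : ∀ j < i, Measurable (a j)) (k : Fin K) (x : S) :
    Measurable fun ω => M.localPrior π N β ηloc (fun j => ξ j ω) (fun j => a j ω) i k x := by
  induction i generalizing k x with
  | zero => exact measurable_const
  | succ i ih =>
    refine Finset.measurable_sum _ fun s' _ => Measurable.mul ?_ ?_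
    · exact (Measurable.of_discrete (f := fun u => M.localTrans π (N.nbhd k) x s' u)).comp
        (ha i i.lt_succ_self)
    · exact M.measurable_combine_adapt N β (hξ i i.lt_succ_self)
        (fun l t => ih (fun j hj => hξ j (hj.trans i.lt_succ_self))
          (fun j hj => ha j (hj.trans i.lt_succ_self)) l t) k s'

theorem measurable_centralBelief {i : ℕ} (hξ : ∀ j < i + 1, Measurable (ξ j))
    (ha : ∀ j < i, Measurable (a j)) (x : S) :
    Measurable fun ω => M.centralBelief ηcen (fun j => ξ j ω) (fun j => a j ω) i x :=
  M.measurable_central_update (hξ i i.lt_succ_self)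
    (measurable_centralPrior (fun j hj => hξ j (hj.trans i.lt_succ_self)) ha) x

theorem measurable_localBelief {i : ℕ} (hξ : ∀ j < i + 1, Measurable (ξ j))
    (ha : ∀ j < i, Measurable (a j)) (k : Fin K) (x : S) :
    Measurable fun ω => M.localBelief π N β ηloc (fun j => ξ j ω) (fun j => a j ω) i k x :=
  M.measurable_combine_adapt N β (hξ i i.lt_succ_self)
    (measurable_localPrior (fun j hj => hξ j (hj.trans i.lt_succ_self)) ha) k x

end Measurability

theorem centralPrior_nonneg (hη : ∀ x, 0 ≤ ηcen x) (x : ℕ → ∀ k, O k) (u : ℕ → ∀ k, A k) (i : ℕ)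
    (s : S) : 0 ≤ M.centralPrior ηcen x u i s := by
  induction i generalizing s with
  | zero => exact hη s
  | succ i ih =>
    exact Finset.sum_nonneg fun s' _ => mul_nonneg (M.trans_nonneg _ _ _)
      (rescale_nonneg (fun t => mul_nonneg (jointLik_nonneg _ t) (ih t)) s')

theorem sameSupport_prior {τ : ℝ} (hτ : M.HopBound π N τ) (h0 : SameSupport ηcen ηloc)
    {x : ℕ → ∀ k, O k} (hx : ∀ i l s, 0 < M.lik l (x i l) s) (u : ℕ → ∀ k, A k) (i : ℕ) :
    SameSupport (M.centralPrior ηcen x u i) (M.localPrior π N β ηloc x u i) := by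
  induction i with
  | zero => exact h0
  | succ i ih => exact (ih.update (hx i)).predict hτ (u i)

theorem sameSupport_belief {τ : ℝ} (hτ : M.HopBound π N τ) (h0 : SameSupport ηcen ηloc)
    {x : ℕ → ∀ k, O k} (hx : ∀ i l s, 0 < M.lik l (x i l) s) (u : ℕ → ∀ k, A k) (i : ℕ) :
    SameSupport (M.centralBelief ηcen x u i) (M.localBelief π N β ηloc x u i) :=
  (sameSupport_prior hτ h0 hx u i).update (hx i)

end DecPOMDP

open DecPOMDP

variable [MeasurableSpace S] [MeasurableSingletonClass S]
  {Ω : Type*} [m0 : MeasurableSpace Ω] {P : Measure Ω} [IsProbabilityMeasure P]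
  {s : ℕ → Ω → S} {ξ : ℕ → Ω → ∀ k, O k} {a : ℕ → Ω → ∀ k, A k}

namespace IsDiffusionProcess

theorem history_le (h : IsDiffusionProcess M π N β ηcen ηloc P s ξ a) (i j k : ℕ) :
    sigmaBefore s i ⊔ sigmaBefore ξ j ⊔ sigmaBefore a k ≤ m0 :=
  sup_le (sup_le (sigmaBefore_le h.measurable_state i) (sigmaBefore_le h.measurable_obs j))
    (sigmaBefore_le h.measurable_act k)

theorem info_le (h : IsDiffusionProcess M π N β ηcen ηloc P s ξ a) (i j : ℕ) :
    sigmaBefore ξ i ⊔ sigmaBefore a j ≤ m0 :=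
  sup_le (sigmaBefore_le h.measurable_obs i) (sigmaBefore_le h.measurable_act j)

theorem info_le_history (i j k : ℕ) : sigmaBefore ξ j ⊔ sigmaBefore a k
    ≤ sigmaBefore s i ⊔ sigmaBefore ξ j ⊔ sigmaBefore a k :=
  sup_le_sup_right le_sup_right _

theorem measurable_info_obs {i j n : ℕ} (hj : j < i) :
    Measurable[sigmaBefore ξ i ⊔ sigmaBefore a n] (ξ j) :=
  (measurable_sigmaBefore hj).mono le_sup_left le_rfl

theorem measurable_info_act {i j n : ℕ} (hj : j < n) :
    Measurable[sigmaBefore ξ i ⊔ sigmaBefore a n] (a j) :=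
  (measurable_sigmaBefore hj).mono le_sup_right le_rfl

theorem measurable_info_centralPrior (i : ℕ) (x : S) :
    Measurable[sigmaBefore ξ i ⊔ sigmaBefore a i]
      fun ω => M.centralPrior ηcen (fun j => ξ j ω) (fun j => a j ω) i x :=
  measurable_centralPrior (ξ := ξ) (a := a)
    (fun j hj => measurable_info_obs (ξ := ξ) (a := a) (i := i) (j := j) (n := i) hj)
    (fun j hj => measurable_info_act (ξ := ξ) (a := a) (i := i) (j := j) (n := i) hj) x

theorem measurable_info_localPrior (i : ℕ) (k : Fin K) (x : S) :
    Measurable[sigmaBefore ξ i ⊔ sigmaBefore a i]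
      fun ω => M.localPrior π N β ηloc (fun j => ξ j ω) (fun j => a j ω) i k x :=
  measurable_localPrior (ξ := ξ) (a := a)
    (fun j hj => measurable_info_obs (ξ := ξ) (a := a) (i := i) (j := j) (n := i) hj)
    (fun j hj => measurable_info_act (ξ := ξ) (a := a) (i := i) (j := j) (n := i) hj) k x

theorem measurable_info_centralBelief (i : ℕ) (x : S) :
    Measurable[sigmaBefore ξ (i + 1) ⊔ sigmaBefore a i]
      fun ω => M.centralBelief ηcen (fun j => ξ j ω) (fun j => a j ω) i x :=
  measurable_centralBelief (ξ := ξ) (a := a)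
    (fun j hj => measurable_info_obs (ξ := ξ) (a := a) (i := i + 1) (j := j) (n := i) hj)
    (fun j hj => measurable_info_act (ξ := ξ) (a := a) (i := i + 1) (j := j) (n := i) hj) x

theorem measurable_info_localBelief (i : ℕ) (k : Fin K) (x : S) :
    Measurable[sigmaBefore ξ (i + 1) ⊔ sigmaBefore a i]
      fun ω => M.localBelief π N β ηloc (fun j => ξ j ω) (fun j => a j ω) i k x :=
  measurable_localBelief (ξ := ξ) (a := a)
    (fun j hj => measurable_info_obs (ξ := ξ) (a := a) (i := i + 1) (j := j) (n := i) hj)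
    (fun j hj => measurable_info_act (ξ := ξ) (a := a) (i := i + 1) (j := j) (n := i) hj) k x

/-- The observation is integrated out, given the state, by the likelihood. -/
theorem setLIntegral_obs (h : IsDiffusionProcess M π N β ηcen ηloc P s ξ a) (i : ℕ) (x : S)
    (hη : P⟦s i ⁻¹' {x} | sigmaBefore ξ i ⊔ sigmaBefore a i⟧
      =ᵐ[P] fun ω => M.centralPrior ηcen (fun j => ξ j ω) (fun j => a j ω) i x)
    {F : Type*} [MeasurableSpace F] {Y : Ω → F}
    (hY : Measurable[sigmaBefore ξ i ⊔ sigmaBefore a i] Y)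
    {f : F × (∀ k, O k) → ℝ≥0∞} (hf : Measurable f) :
    ∫⁻ ω in s i ⁻¹' {x}, f (Y ω, ξ i ω) ∂P
      = ∫⁻ ω, ENNReal.ofReal (M.centralPrior ηcen (fun j => ξ j ω) (fun j => a j ω) i x) *
          ∫⁻ y, f (Y ω, y) ∂(M.jointObsLaw x) ∂P := by
  have hs : Measurable[sigmaBefore s (i + 1) ⊔ sigmaBefore ξ i ⊔ sigmaBefore a i] (s i) :=
    (measurable_sigmaBefore i.lt_succ_self).mono (le_sup_left.trans le_sup_left) le_rfl
  -- On the event that the state is x, the law of the observation given the full history is the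
  -- fixed measure `jointObsLaw x`. Once the observation is integrated out, what remains depends on
  -- the joint information only, and the event is replaced by its conditional probability.
  rw [setLIntegral_freeze (h.history_le (i + 1) i i) (h.measurable_obs i)
    (hY.mono (info_le_history _ _ _) le_rfl) (hs (measurableSet_singleton x))
    (Λ := M.jointObsLaw x) (fun t ht => ⟨_, h.obs i t ht, fun ω hω => by
      rw [show s i ω = x from hω]⟩) hf]
  exact setLIntegral_eq_lintegral_condProb_mul (h.info_le i i)
    (h.measurable_state i (measurableSet_singleton x)) hη (hf.lintegral_prod_right'.comp hY)

/-- The predictive law of the observation. -/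
theorem lintegral_obs (h : IsDiffusionProcess M π N β ηcen ηloc P s ξ a) (i : ℕ)
    (hη : ∀ x, P⟦s i ⁻¹' {x} | sigmaBefore ξ i ⊔ sigmaBefore a i⟧
      =ᵐ[P] fun ω => M.centralPrior ηcen (fun j => ξ j ω) (fun j => a j ω) i x)
    {F : Type*} [MeasurableSpace F] {Y : Ω → F}
    (hY : Measurable[sigmaBefore ξ i ⊔ sigmaBefore a i] Y)
    {f : F × (∀ k, O k) → ℝ≥0∞} (hf : Measurable f) :
    ∫⁻ ω, f (Y ω, ξ i ω) ∂P
      = ∫⁻ ω, ∑ x, ENNReal.ofReal (M.centralPrior ηcen (fun j => ξ j ω) (fun j => a j ω) i x) *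
          ∫⁻ y, f (Y ω, y) ∂(M.jointObsLaw x) ∂P := by
  rw [lintegral_eq_sum_fiber (h.measurable_state i), lintegral_finsetSum]
  · exact Finset.sum_congr rfl fun x _ => h.setLIntegral_obs i x (hη x) hY hf
  · intro x _
    have h1 : Measurable fun ω => ∫⁻ y, f (Y ω, y) ∂(M.jointObsLaw x) :=
      hf.lintegral_prod_right'.comp (hY.mono (h.info_le i i) le_rfl)
    have h2 : Measurable fun ω => M.centralPrior ηcen (fun j => ξ j ω) (fun j => a j ω) i x :=
      measurable_centralPrior (fun j _ => h.measurable_obs j) (fun j _ => h.measurable_act j) x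
    exact h2.ennreal_ofReal.mul h1

/-- Bayes' rule: the posterior after the observation. -/
theorem condProb_belief (h : IsDiffusionProcess M π N β ηcen ηloc P s ξ a)
    (hηcen : ∀ x, 0 ≤ ηcen x) (i : ℕ)
    (hη : ∀ x, P⟦s i ⁻¹' {x} | sigmaBefore ξ i ⊔ sigmaBefore a i⟧
      =ᵐ[P] fun ω => M.centralPrior ηcen (fun j => ξ j ω) (fun j => a j ω) i x) (x : S) :
    P⟦s i ⁻¹' {x} | sigmaBefore ξ (i + 1) ⊔ sigmaBefore a i⟧
      =ᵐ[P] fun ω => M.centralBelief ηcen (fun j => ξ j ω) (fun j => a j ω) i x := by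
  have hsup : sigmaBefore ξ (i + 1) ⊔ sigmaBefore a i
      = (sigmaBefore ξ i ⊔ sigmaBefore a i) ⊔ MeasurableSpace.comap (ξ i) inferInstance := by
    rw [sigmaBefore_succ, sup_right_comm]
  have hmeas : Measurable[sigmaBefore ξ (i + 1) ⊔ sigmaBefore a i]
      fun ω => M.centralBelief ηcen (fun j => ξ j ω) (fun j => a j ω) i x :=
    measurable_info_centralBelief i x
  have hprior : ∀ ω x, 0 ≤ M.centralPrior ηcen (fun j => ξ j ω) (fun j => a j ω) i x :=
    fun ω x => centralPrior_nonneg hηcen _ _ i x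
  have hnn : ∀ ω x, 0 ≤ M.jointLik (ξ i ω) x *
      M.centralPrior ηcen (fun j => ξ j ω) (fun j => a j ω) i x :=
    fun ω x => mul_nonneg (jointLik_nonneg _ x) (hprior ω x)
  rw [hsup] at hmeas ⊢
  refine condProb_sup_eq (h.info_le i i) (h.measurable_obs i).comap_le
    (h.measurable_state i (measurableSet_singleton x)) hmeas
    (fun ω => rescale_nonneg (hnn ω) x) (ae_of_all _ fun ω => rescale_le_one (hnn ω) x) ?_
  rintro E _ hE ⟨t, ht, rfl⟩
  have hE0 := h.info_le i i E hE
  have hEt : MeasurableSet (E ∩ ξ i ⁻¹' t) := hE0.inter (h.measurable_obs i ht)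
  set η : Ω → S → ℝ := fun ω => M.centralPrior ηcen (fun j => ξ j ω) (fun j => a j ω) i with hηdef
  have hηm : Measurable[sigmaBefore ξ i ⊔ sigmaBefore a i] η :=
    @measurable_pi_lambda _ _ _ (sigmaBefore ξ i ⊔ sigmaBefore a i) _ _ fun x =>
      measurable_info_centralPrior i x
  have hindm : Measurable[sigmaBefore ξ i ⊔ sigmaBefore a i] (E.indicator (1 : Ω → ℝ≥0∞)) :=
    Measurable.indicator (f := fun _ => 1) measurable_const hE
  set Y : Ω → (S → ℝ) × ℝ≥0∞ := fun ω => (η ω, E.indicator 1 ω) with hYdef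
  have hY : Measurable[sigmaBefore ξ i ⊔ sigmaBefore a i] Y := hηm.prodMk hindm
  -- `Y` stores the prior and the indicator of `E`, both known before the observation. Thus `f` is
  -- the indicator of the test event, and `g` below is that indicator times the posterior.
  set f : ((S → ℝ) × ℝ≥0∞) × (∀ k, O k) → ℝ≥0∞ := fun q => q.1.2 * t.indicator 1 q.2 with hfdef
  have hf : Measurable f := (measurable_snd.comp measurable_fst).mul
    ((measurable_one.indicator ht).comp measurable_snd)
  set g : ((S → ℝ) × ℝ≥0∞) × (∀ k, O k) → ℝ≥0∞ := fun q =>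
    f q * ENNReal.ofReal (rescale (fun y => M.jointLik q.2 y * q.1.1 y) x) with hgdef
  have hg : Measurable g := hf.mul (M.measurable_central_update measurable_snd
    (fun y => (measurable_pi_apply y).comp (measurable_fst.comp measurable_fst)) x).ennreal_ofReal
  have hfY : ∀ ω, f (Y ω, ξ i ω) = (E ∩ ξ i ⁻¹' t).indicator 1 ω := fun ω => by
    by_cases h1 : ω ∈ E <;> by_cases h2 : ξ i ω ∈ t <;> simp [hfdef, hYdef, h1, h2]
  have hL : P (s i ⁻¹' {x} ∩ (E ∩ ξ i ⁻¹' t))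
      = ∫⁻ ω in s i ⁻¹' {x}, f (Y ω, ξ i ω) ∂P := by
    simp only [hfY]
    rw [lintegral_indicator_one hEt, Measure.restrict_apply hEt, Set.inter_comm]
  have hR : ∫⁻ ω in E ∩ ξ i ⁻¹' t, ENNReal.ofReal
        (M.centralBelief ηcen (fun j => ξ j ω) (fun j => a j ω) i x) ∂P
      = ∫⁻ ω, g (Y ω, ξ i ω) ∂P := by
    rw [← lintegral_indicator hEt]
    refine lintegral_congr fun ω => ?_
    simp only [hgdef, hfY]
    by_cases h1 : ω ∈ E ∩ ξ i ⁻¹' t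
    · rw [Set.indicator_of_mem h1, Set.indicator_of_mem h1, Pi.one_apply, one_mul]; rfl
    · rw [Set.indicator_of_notMem h1, Set.indicator_of_notMem h1, zero_mul]
  rw [hL, hR, h.setLIntegral_obs i x (hη x) hY hf, h.lintegral_obs i hη hY hg]
  refine lintegral_congr fun ω => ?_
  have hfω : Measurable fun y => f (Y ω, y) := hf.comp measurable_prodMk_left
  have hgω : Measurable fun y => g (Y ω, y) := hg.comp measurable_prodMk_left
  have hlik : ∀ y, Measurable fun ξ => ENNReal.ofReal (M.jointLik ξ y) := fun y =>
    (M.measurable_jointLik (x := fun ξ => ξ) measurable_id y).ennreal_ofReal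
  simp only [M.lintegral_jointObsLaw _ hfω, M.lintegral_jointObsLaw _ hgω]
  have e1 : ∀ y, Measurable fun ξ => ENNReal.ofReal (M.jointLik ξ y) * f (Y ω, ξ) :=
    fun y => (hlik y).mul hfω
  have e2 : ∀ y, Measurable fun ξ => ENNReal.ofReal (M.jointLik ξ y) * g (Y ω, ξ) :=
    fun y => (hlik y).mul hgω
  rw [← lintegral_const_mul _ (e1 x), Finset.sum_congr rfl fun y _ =>
    (lintegral_const_mul (ENNReal.ofReal (η ω y)) (e2 y)).symm,
    ← lintegral_finsetSum _ fun y _ => (e2 y).const_mul _]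
  refine lintegral_congr fun y => ?_
  -- Bayes' rule pointwise: predictive density times posterior equals likelihood times prior.
  have hbayes := sum_mul_rescale
    (fun x => mul_nonneg (jointLik_nonneg (M := M) y x) (hprior ω x)) x
  have e3 : ∀ z, ENNReal.ofReal (η ω z) * (ENNReal.ofReal (M.jointLik y z) * g (Y ω, y))
      = f (Y ω, y) * ENNReal.ofReal ((M.jointLik y z * η ω z) *
        rescale (fun z => M.jointLik y z * η ω z) x) := fun z => by
    rw [ENNReal.ofReal_mul (mul_nonneg (jointLik_nonneg y z) (hprior ω z)),
      ENNReal.ofReal_mul (jointLik_nonneg y z)]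
    simp only [hgdef, hYdef]
    ring
  simp only [e3]
  rw [← Finset.mul_sum, ← ENNReal.ofReal_sum_of_nonneg fun z _ => mul_nonneg
    (mul_nonneg (jointLik_nonneg y z) (hprior ω z))
    (rescale_nonneg (fun x => mul_nonneg (jointLik_nonneg (M := M) y x) (hprior ω x)) x),
    ← Finset.sum_mul, hbayes, ENNReal.ofReal_mul (jointLik_nonneg y x)]
  ring

end IsDiffusionProcess

end DiffusionProcess

/-! ### Actions and transitions: the centralized priors are the conditional laws. -/

section Prediction

open DecPOMDP

variable {K : ℕ} {S : Type*} {A O : Fin K → Type*} [Fintype S]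
  [∀ k, Fintype (A k)] [∀ k, MeasurableSpace (A k)] [∀ k, MeasurableSingletonClass (A k)]
  [∀ k, MeasurableSpace (O k)]
  {M : DecPOMDP K S A O} {π : JointPolicy K S A} {N : Network K} {β : ℝ}
  {ηcen : S → ℝ} {ηloc : Fin K → S → ℝ}
  [MeasurableSpace S] [MeasurableSingletonClass S]
  {Ω : Type*} [m0 : MeasurableSpace Ω] {P : Measure Ω} [IsProbabilityMeasure P]
  {s : ℕ → Ω → S} {ξ : ℕ → Ω → ∀ k, O k} {a : ℕ → Ω → ∀ k, A k}

namespace IsDiffusionProcess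

/-- Actions depend on the state only through the information, so that they do not change the
posterior. -/
theorem measure_act_state (h : IsDiffusionProcess M π N β ηcen ηloc P s ξ a) (i : ℕ) (x : S)
    (hμ : P⟦s i ⁻¹' {x} | sigmaBefore ξ (i + 1) ⊔ sigmaBefore a i⟧
      =ᵐ[P] fun ω => M.centralBelief ηcen (fun j => ξ j ω) (fun j => a j ω) i x)
    (u : ∀ k, A k) {E : Set Ω} (hE : MeasurableSet[sigmaBefore ξ (i + 1) ⊔ sigmaBefore a i] E) :
    P (a i ⁻¹' {u} ∩ (s i ⁻¹' {x} ∩ E)) = ∫⁻ ω in a i ⁻¹' {u}, E.indicator (fun ω =>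
      ENNReal.ofReal (M.centralBelief ηcen (fun j => ξ j ω) (fun j => a j ω) i x)) ω ∂P := by
  have hle := h.info_le (i + 1) i
  have hleH := h.history_le (i + 1) (i + 1) i
  have hsub : sigmaBefore ξ (i + 1) ⊔ sigmaBefore a i
    ≤ sigmaBefore s (i + 1) ⊔ sigmaBefore ξ (i + 1) ⊔ sigmaBefore a i := info_le_history _ _ _
  have hu : MeasurableSet (a i ⁻¹' {u}) := h.measurable_act i (measurableSet_singleton u)
  have hx : MeasurableSet (s i ⁻¹' {x}) := h.measurable_state i (measurableSet_singleton x)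
  have hxH : MeasurableSet[sigmaBefore s (i + 1) ⊔ sigmaBefore ξ (i + 1) ⊔ sigmaBefore a i]
      (s i ⁻¹' {x}) :=
    (measurable_sigmaBefore i.lt_succ_self).mono (le_sup_left.trans le_sup_left) le_rfl
      (measurableSet_singleton x)
  have hμm : Measurable[sigmaBefore ξ (i + 1) ⊔ sigmaBefore a i] fun ω =>
      ENNReal.ofReal (M.centralBelief ηcen (fun j => ξ j ω) (fun j => a j ω) i x) :=
    Measurable.ennreal_ofReal (measurable_info_centralBelief i x)
  have hρm : Measurable[sigmaBefore ξ (i + 1) ⊔ sigmaBefore a i] fun ω =>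
      ENNReal.ofReal (∏ k, π.prob k
        (M.localBelief π N β ηloc (fun j => ξ j ω) (fun j => a j ω) i k) (u k)) := by
    refine Measurable.ennreal_ofReal (Finset.measurable_prod _ fun k _ => ?_)
    have hloc : Measurable[sigmaBefore ξ (i + 1) ⊔ sigmaBefore a i] fun ω =>
        M.localBelief π N β ηloc (fun j => ξ j ω) (fun j => a j ω) i k :=
      @measurable_pi_lambda _ _ _ (sigmaBefore ξ (i + 1) ⊔ sigmaBefore a i) _ _
        fun x => measurable_info_localBelief i k x
    exact (π.prob_measurable k (u k)).comp hloc
  set ρ : Ω → ℝ≥0∞ := fun ω => ENNReal.ofReal (∏ k, π.prob k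
        (M.localBelief π N β ηloc (fun j => ξ j ω) (fun j => a j ω) i k) (u k)) with hρ
  set μ : Ω → ℝ≥0∞ := fun ω =>
    ENNReal.ofReal (M.centralBelief ηcen (fun j => ξ j ω) (fun j => a j ω) i x) with hμdef
  -- Both sides equal the integral of ρ μ over `E`. Given the full history the action has
  -- probability ρ (`h1`, `h2`). Since ρ is a function of the joint information alone, the state
  -- event can afterwards be replaced by its posterior μ (`h3`).
  have h1 := setLIntegral_eq_lintegral_condProb_mul hleH hu (h.act i u)
    (g := (s i ⁻¹' {x} ∩ E).indicator fun _ => 1)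
    (Measurable.indicator measurable_const (hxH.inter (hsub E hE)))
  have h2 := setLIntegral_eq_lintegral_condProb_mul hleH hu (h.act i u)
    (g := E.indicator μ) ((Measurable.indicator hμm hE).mono hsub le_rfl)
  have h3 := setLIntegral_eq_lintegral_condProb_mul hle hx hμ (g := E.indicator ρ)
    (Measurable.indicator hρm hE)
  rw [lintegral_indicator_const (hx.inter (hle E hE)), one_mul,
    Measure.restrict_apply (hx.inter (hle E hE)), Set.inter_comm] at h1
  rw [h1, h2]
  have h4 : ∫⁻ ω, ρ ω * (s i ⁻¹' {x} ∩ E).indicator (fun _ => 1) ω ∂P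
      = ∫⁻ ω in s i ⁻¹' {x}, E.indicator ρ ω ∂P := by
    rw [← lintegral_indicator hx]
    refine lintegral_congr fun ω => ?_
    by_cases h5 : ω ∈ s i ⁻¹' {x} <;> by_cases h6 : ω ∈ E <;> simp [h5, h6]
  refine (h4.trans h3).trans (lintegral_congr fun ω => ?_)
  by_cases h6 : ω ∈ E <;> simp [h6, hμdef, hρ, mul_comm]

/-- The prior for the next state, given the information up to the actions. -/
theorem condProb_prior_succ (h : IsDiffusionProcess M π N β ηcen ηloc P s ξ a)
    (hηcen : ∀ x, 0 ≤ ηcen x) (i : ℕ)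
    (hμ : ∀ x, P⟦s i ⁻¹' {x} | sigmaBefore ξ (i + 1) ⊔ sigmaBefore a i⟧
      =ᵐ[P] fun ω => M.centralBelief ηcen (fun j => ξ j ω) (fun j => a j ω) i x) (x : S) :
    P⟦s (i + 1) ⁻¹' {x} | sigmaBefore ξ (i + 1) ⊔ sigmaBefore a (i + 1)⟧
      =ᵐ[P] fun ω => M.centralPrior ηcen (fun j => ξ j ω) (fun j => a j ω) (i + 1) x := by
  have hsup : sigmaBefore ξ (i + 1) ⊔ sigmaBefore a (i + 1)
      = (sigmaBefore ξ (i + 1) ⊔ sigmaBefore a i) ⊔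
        MeasurableSpace.comap (a i) inferInstance := by
    rw [sigmaBefore_succ (X := a), sup_assoc]
  have hmeas : Measurable[sigmaBefore ξ (i + 1) ⊔ sigmaBefore a (i + 1)]
      fun ω => M.centralPrior ηcen (fun j => ξ j ω) (fun j => a j ω) (i + 1) x :=
    measurable_info_centralPrior (i + 1) x
  have hnn : ∀ ω x, 0 ≤ M.jointLik (ξ i ω) x *
      M.centralPrior ηcen (fun j => ξ j ω) (fun j => a j ω) i x :=
    fun ω x => mul_nonneg (jointLik_nonneg _ x) (centralPrior_nonneg hηcen _ _ i x)
  have hμ0 : ∀ ω y, 0 ≤ M.centralBelief ηcen (fun j => ξ j ω) (fun j => a j ω) i y :=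
    fun ω y => rescale_nonneg (hnn ω) y
  have hprior : ∀ ω, M.centralPrior ηcen (fun j => ξ j ω) (fun j => a j ω) (i + 1) x
      = ∑ y, M.trans x y (a i ω) * M.centralBelief ηcen (fun j => ξ j ω) (fun j => a j ω) i y :=
    fun ω => rfl
  have hle1 : ∀ ω, M.centralPrior ηcen (fun j => ξ j ω) (fun j => a j ω) (i + 1) x ≤ 1 := by
    intro ω
    rw [hprior]
    calc ∑ y, M.trans x y (a i ω) *
          M.centralBelief ηcen (fun j => ξ j ω) (fun j => a j ω) i y
        ≤ ∑ y, M.centralBelief ηcen (fun j => ξ j ω) (fun j => a j ω) i y := by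
          refine Finset.sum_le_sum fun y _ => mul_le_of_le_one_left (hμ0 ω y) ?_
          rw [← M.trans_sum y (a i ω)]
          exact Finset.single_le_sum (fun z _ => M.trans_nonneg z y (a i ω)) (Finset.mem_univ x)
      _ ≤ 1 := by
          simp only [centralBelief, rescale, ← Finset.sum_div]
          exact div_self_le_one _
  rw [hsup] at hmeas ⊢
  refine condProb_sup_eq (h.info_le (i + 1) i) (h.measurable_act i).comap_le
    (h.measurable_state (i + 1) (measurableSet_singleton x)) hmeas
    (fun ω => centralPrior_nonneg hηcen _ _ (i + 1) x) (ae_of_all _ hle1) ?_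
  rintro E _ hE ⟨U, hU, rfl⟩
  have hE0 := h.info_le (i + 1) i E hE
  have hG : MeasurableSet (E ∩ a i ⁻¹' U) := hE0.inter (h.measurable_act i hU)
  have hGH : MeasurableSet[sigmaBefore s (i + 1) ⊔ sigmaBefore ξ (i + 1) ⊔ sigmaBefore a (i + 1)]
      (E ∩ a i ⁻¹' U) := by
    refine MeasurableSet.inter ?_ ?_
    · exact (info_le_history (i + 1) (i + 1) i).trans
        (sup_le_sup_left (sigmaBefore_mono i.le_succ) _) E hE
    · exact (measurable_sigmaBefore i.lt_succ_self).mono le_sup_right le_rfl hU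
  rw [← ofReal_setIntegral_condProb (h.history_le (i + 1) (i + 1) (i + 1))
    (h.measurable_state (i + 1) (measurableSet_singleton x)) (h.step i x) hGH,
    ← lintegral_indicator hG, ← lintegral_indicator hG,
    lintegral_eq_sum_fiber (h.measurable_act i), lintegral_eq_sum_fiber (h.measurable_act i)]
  refine Finset.sum_congr rfl fun u _ => ?_
  have hu : MeasurableSet (a i ⁻¹' {u}) := h.measurable_act i (measurableSet_singleton u)
  by_cases huU : u ∈ U
  swap
  · have hzero : ∀ g : Ω → ℝ≥0∞,
        ∫⁻ ω in a i ⁻¹' {u}, (E ∩ a i ⁻¹' U).indicator g ω ∂P = 0 := by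
      intro g
      rw [setLIntegral_congr_fun (g := fun _ => 0) hu fun ω hω => ?_, lintegral_zero]
      refine Set.indicator_of_notMem (fun h' => huU ?_) _
      rw [← show a i ω = u from hω]
      exact h'.2
    rw [hzero, hzero]
  -- With action and state both fixed, the transition probability is a constant. `measure_act_state`
  -- then exchanges each state event for its posterior, which yields the terms of the next prior.
  have hL : ∫⁻ ω in a i ⁻¹' {u}, (E ∩ a i ⁻¹' U).indicator
        (fun ω => ENNReal.ofReal (M.trans x (s i ω) (a i ω))) ω ∂P
      = ∑ y, ENNReal.ofReal (M.trans x y u) * P (a i ⁻¹' {u} ∩ (s i ⁻¹' {y} ∩ E)) := by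
    rw [lintegral_eq_sum_fiber (h.measurable_state i)]
    refine Finset.sum_congr rfl fun y _ => ?_
    have hy : MeasurableSet (s i ⁻¹' {y}) := h.measurable_state i (measurableSet_singleton y)
    rw [Measure.restrict_restrict hy, setLIntegral_congr_fun
      (g := E.indicator fun _ => ENNReal.ofReal (M.trans x y u)) (hy.inter hu) fun ω hω => ?_,
      lintegral_indicator_const hE0, Measure.restrict_apply hE0]
    · congr 2
      ext ω
      simp only [Set.mem_inter_iff]
      tauto
    · have h1 : s i ω = y := hω.1
      have h2 : a i ω = u := hω.2
      have h3 : ω ∈ a i ⁻¹' U := by rw [Set.mem_preimage, h2]; exact huU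
      by_cases hωE : ω ∈ E
      · have hmem : ω ∈ E ∩ a i ⁻¹' U := ⟨hωE, h3⟩
        rw [Set.indicator_of_mem hmem, Set.indicator_of_mem hωE, h1, h2]
      · rw [Set.indicator_of_notMem fun h' => hωE h'.1, Set.indicator_of_notMem hωE]
  rw [hL]
  have hR : ∫⁻ ω in a i ⁻¹' {u}, (E ∩ a i ⁻¹' U).indicator (fun ω => ENNReal.ofReal
        (M.centralPrior ηcen (fun j => ξ j ω) (fun j => a j ω) (i + 1) x)) ω ∂P
      = ∫⁻ ω in a i ⁻¹' {u}, ∑ y, ENNReal.ofReal (M.trans x y u) * E.indicator (fun ω =>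
          ENNReal.ofReal (M.centralBelief ηcen (fun j => ξ j ω) (fun j => a j ω) i y)) ω ∂P := by
    refine setLIntegral_congr_fun hu fun ω hω => ?_
    have h2 : a i ω = u := hω
    have h3 : ω ∈ a i ⁻¹' U := by rw [Set.mem_preimage, h2]; exact huU
    by_cases hωE : ω ∈ E
    · have hmem : ω ∈ E ∩ a i ⁻¹' U := ⟨hωE, h3⟩
      simp only [Set.indicator_of_mem hmem, Set.indicator_of_mem hωE]
      rw [hprior, ENNReal.ofReal_sum_of_nonneg fun y _ =>
        mul_nonneg (M.trans_nonneg _ _ _) (hμ0 ω y)]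
      exact Finset.sum_congr rfl fun y _ => by rw [ENNReal.ofReal_mul (M.trans_nonneg _ _ _), h2]
    · rw [Set.indicator_of_notMem fun h' => hωE h'.1]
      simp [Set.indicator_of_notMem hωE]
  have hm : ∀ y, Measurable (E.indicator fun ω =>
      ENNReal.ofReal (M.centralBelief ηcen (fun j => ξ j ω) (fun j => a j ω) i y)) := by
    intro y
    have h1 : Measurable fun ω => M.centralBelief ηcen (fun j => ξ j ω) (fun j => a j ω) i y :=
      (measurable_info_centralBelief i y).mono (h.info_le (i + 1) i) le_rfl
    exact h1.ennreal_ofReal.indicator hE0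
  rw [hR, lintegral_finsetSum _ fun y _ => (hm y).const_mul _]
  refine Finset.sum_congr rfl fun y _ => ?_
  rw [lintegral_const_mul _ (hm y), h.measure_act_state i y (hμ y) u hE]

/-- The centralized priors and beliefs are the posteriors given the joint history. -/
theorem condProb_prior (h : IsDiffusionProcess M π N β ηcen ηloc P s ξ a)
    (hηcen : ∀ x, 0 ≤ ηcen x) (i : ℕ) (x : S) :
    P⟦s i ⁻¹' {x} | sigmaBefore ξ i ⊔ sigmaBefore a i⟧
      =ᵐ[P] fun ω => M.centralPrior ηcen (fun j => ξ j ω) (fun j => a j ω) i x := by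
  induction i generalizing x with
  | zero =>
    rw [sigmaBefore_zero, sigmaBefore_zero, sup_bot_eq, condExp_bot]
    refine ae_of_all _ fun ω => ?_
    simp only
    rw [integral_indicator (h.measurable_state 0 (measurableSet_singleton x)),
      setIntegral_const, smul_eq_mul, mul_one]
    exact h.init x
  | succ i ih => exact h.condProb_prior_succ hηcen i (h.condProb_belief hηcen i ih) x

theorem ae_lik_pos (h : IsDiffusionProcess M π N β ηcen ηloc P s ξ a) {B : ℝ}
    (hB : M.BoundedLik B) : ∀ᵐ ω ∂P, ∀ i l x, 0 < M.lik l (ξ i ω l) x := by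
  rw [ae_all_iff]
  intro i
  have hG : MeasurableSet {y : ∀ k, O k | ∀ l x, 0 < M.lik l (y l) x} := by
    simp only [Set.ofPred_forall]
    exact MeasurableSet.iInter fun l => MeasurableSet.iInter fun x =>
      measurableSet_lt measurable_const (M.measurable_lik (x := fun y => y) measurable_id l x)
  have h0 : ∀ x, M.jointObsLaw x {y : ∀ k, O k | ∀ l x, 0 < M.lik l (y l) x}ᶜ = 0 := fun x =>
    (hB.ae_jointObsLaw x).mono fun y hy l x => (hy l x).1
  have h1 := ofReal_setIntegral_condProb (h.history_le (i + 1) i i)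
    (h.measurable_obs i hG.compl) (h.obs i _ hG.compl) MeasurableSet.univ
  simp only [measureReal_def, h0, ENNReal.toReal_zero, ENNReal.ofReal_zero, lintegral_zero,
    Set.inter_univ] at h1
  exact h1.symm

end IsDiffusionProcess

end Prediction

/-! ### One-step inequalities for the risks, and their iteration. -/

section RiskBounds

open DecPOMDP

variable {K : ℕ} {S : Type*} {A O : Fin K → Type*} [Fintype S]
  [∀ k, Fintype (A k)] [∀ k, MeasurableSpace (A k)] [∀ k, MeasurableSingletonClass (A k)]
  [∀ k, MeasurableSpace (O k)]
  {M : DecPOMDP K S A O} {π : JointPolicy K S A} {N : Network K} {β : ℝ}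
  {ηcen : S → ℝ} {ηloc : Fin K → S → ℝ}
  [MeasurableSpace S] [MeasurableSingletonClass S]
  {Ω : Type*} [m0 : MeasurableSpace Ω] {P : Measure Ω} [IsProbabilityMeasure P]
  {s : ℕ → Ω → S} {ξ : ℕ → Ω → ∀ k, O k} {a : ℕ → Ω → ∀ k, A k} {B τ κ : ℝ}

theorem DecPOMDP.BoundedLik.nonneg [Nonempty S] (hB : M.BoundedLik B) (k : Fin K) : 0 ≤ B := by
  obtain ⟨x⟩ := ‹Nonempty S›
  obtain ⟨ξ, hξ⟩ := (hB.ae_jointObsLaw x).exists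
  exact (abs_nonneg _).trans (hξ k x).2

theorem SameSupport.beliefKL_eq {η : S → ℝ} {ηs : Fin K → S → ℝ} (h : SameSupport η ηs)
    (k : Fin K) : beliefKL η (ηs k) = ENNReal.ofReal (klSum η (ηs k)) :=
  _root_.beliefKL_eq h.central.1 (h.local_mem k).1 fun x => (h.eq_zero_iff k x).1

theorem measurable_klSum_update (k : Fin K) :
    Measurable fun q : ((S → ℝ) × (Fin K → S → ℝ)) × (∀ k, O k) =>
      klSum (rescale fun t => M.jointLik q.2 t * q.1.1 t) (combine N (M.adapt β q.2 q.1.2) k) := by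
  have h1 : ∀ x, Measurable fun q : ((S → ℝ) × (Fin K → S → ℝ)) × (∀ k, O k) => q.1.1 x :=
    fun x => by fun_prop
  have h2 : ∀ l x, Measurable fun q : ((S → ℝ) × (Fin K → S → ℝ)) × (∀ k, O k) => q.1.2 l x :=
    fun l x => by fun_prop
  exact measurable_klSum (M.measurable_central_update measurable_snd h1)
    (M.measurable_combine_adapt N β measurable_snd h2 k)

namespace IsDiffusionProcess

theorem priorRisk_eq (h : IsDiffusionProcess M π N β ηcen ηloc P s ξ a) (hB : M.BoundedLik B)
    (hτ : M.HopBound π N τ) (h0 : SameSupport ηcen ηloc) (k : Fin K) (i : ℕ) :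
    priorRisk M π N β ηcen ηloc P ξ a k i = ∫⁻ ω, ENNReal.ofReal (klSum
      (M.centralPrior ηcen (fun j => ξ j ω) (fun j => a j ω) i)
      (M.localPrior π N β ηloc (fun j => ξ j ω) (fun j => a j ω) i k)) ∂P :=
  lintegral_congr_ae <| (h.ae_lik_pos hB).mono fun _ hω =>
    (sameSupport_prior hτ h0 hω _ i).beliefKL_eq k

theorem postRisk_eq (h : IsDiffusionProcess M π N β ηcen ηloc P s ξ a) (hB : M.BoundedLik B)
    (hτ : M.HopBound π N τ) (h0 : SameSupport ηcen ηloc) (k : Fin K) (i : ℕ) :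
    postRisk M π N β ηcen ηloc P ξ a k i = ∫⁻ ω, ENNReal.ofReal (klSum
      (M.centralBelief ηcen (fun j => ξ j ω) (fun j => a j ω) i)
      (M.localBelief π N β ηloc (fun j => ξ j ω) (fun j => a j ω) i k)) ∂P :=
  lintegral_congr_ae <| (h.ae_lik_pos hB).mono fun _ hω =>
    (sameSupport_belief hτ h0 hω _ i).beliefKL_eq k

/-- Given the past information, the observation follows the mixture of the likelihoods with weights
η_i, which is exactly the law under which the averaged update bound holds. -/
theorem postRisk_le (h : IsDiffusionProcess M π N β ηcen ηloc P s ξ a) (hB : M.BoundedLik B)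
    (hτ : M.HopBound π N τ) (h0 : SameSupport ηcen ηloc) (k : Fin K) {R : ℝ}
    (hR : (∑ l, |1 - β * N.weight l k|) * B ≤ R) (i : ℕ) :
    postRisk M π N β ηcen ηloc P ξ a k i ≤
      ∑ l, ENNReal.ofReal (N.weight l k) * priorRisk M π N β ηcen ηloc P ξ a l i
        + ENNReal.ofReal (2 * R) := by
  set η : Ω → S → ℝ := fun ω => M.centralPrior ηcen (fun j => ξ j ω) (fun j => a j ω) i with hη
  set ηs : Ω → Fin K → S → ℝ := fun ω =>
    M.localPrior π N β ηloc (fun j => ξ j ω) (fun j => a j ω) i with hηs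
  have hηm : Measurable[sigmaBefore ξ i ⊔ sigmaBefore a i] η :=
    @measurable_pi_lambda _ _ _ (sigmaBefore ξ i ⊔ sigmaBefore a i) _ _ fun x =>
      measurable_info_centralPrior i x
  have hηsm : Measurable[sigmaBefore ξ i ⊔ sigmaBefore a i] ηs :=
    @measurable_pi_lambda _ _ _ (sigmaBefore ξ i ⊔ sigmaBefore a i) _ _ fun l =>
      @measurable_pi_lambda _ _ _ (sigmaBefore ξ i ⊔ sigmaBefore a i) _ _ fun x =>
        measurable_info_localPrior i l x
  set f : ((S → ℝ) × (Fin K → S → ℝ)) × (∀ k, O k) → ℝ≥0∞ := fun q => ENNReal.ofReal (klSum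
    (rescale fun t => M.jointLik q.2 t * q.1.1 t) (combine N (M.adapt β q.2 q.1.2) k)) with hf
  have hfm : Measurable f := (measurable_klSum_update k).ennreal_ofReal
  have hkl : ∀ l, Measurable fun ω => ENNReal.ofReal (klSum (η ω) (ηs ω l)) := by
    intro l
    have h1 : ∀ x, Measurable fun ω => η ω x := fun x =>
      measurable_centralPrior (fun j _ => h.measurable_obs j) (fun j _ => h.measurable_act j) x
    have h2 : ∀ x, Measurable fun ω => ηs ω l x := fun x =>
      measurable_localPrior (fun j _ => h.measurable_obs j) (fun j _ => h.measurable_act j) l x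
    exact (measurable_klSum h1 h2).ennreal_ofReal
  have h1 : postRisk M π N β ηcen ηloc P ξ a k i = ∫⁻ ω, f ((η ω, ηs ω), ξ i ω) ∂P :=
    h.postRisk_eq hB hτ h0 k i
  rw [h1, h.lintegral_obs i (fun x => h.condProb_prior (fun x => h0.central.1 x) i x)
    (Y := fun ω => (η ω, ηs ω)) (hηm.prodMk hηsm) hfm]
  calc ∫⁻ ω, ∑ x, ENNReal.ofReal (η ω x) * ∫⁻ y, f ((η ω, ηs ω), y) ∂(M.jointObsLaw x) ∂P
      ≤ ∫⁻ ω, (∑ l, ENNReal.ofReal (N.weight l k) * ENNReal.ofReal (klSum (η ω) (ηs ω l))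
          + ENNReal.ofReal (2 * R)) ∂P := by
        refine lintegral_mono_ae ?_
        filter_upwards [h.ae_lik_pos hB] with ω hω
        have hsupp : SameSupport (η ω) (ηs ω) := sameSupport_prior hτ h0 hω _ i
        refine (sum_lintegral_klSum_update_le hB hsupp k hR).trans ?_
        refine ENNReal.ofReal_add_le.trans (add_le_add ?_ le_rfl)
        rw [ENNReal.ofReal_sum_of_nonneg fun l _ => mul_nonneg (N.weight_nonneg l k)
          (klSum_nonneg hsupp.central.1 (hsupp.local_mem l).1)]
        exact (Finset.sum_congr rfl fun l _ => ENNReal.ofReal_mul (N.weight_nonneg l k)).le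
    _ = _ := by
        rw [lintegral_add_right _ measurable_const, lintegral_const, measure_univ, mul_one,
          lintegral_finsetSum _ fun l _ => (hkl l).const_mul _]
        congr 1
        refine Finset.sum_congr rfl fun l _ => ?_
        rw [lintegral_const_mul _ (hkl l), h.priorRisk_eq hB hτ h0 l i]

/-- Contraction and kernel replacement hold on almost every path; taking expectations is all that is
left. -/
theorem priorRisk_succ_le (h : IsDiffusionProcess M π N β ηcen ηloc P s ξ a)
    (hB : M.BoundedLik B) (hτ : M.HopBound π N τ) (h0 : SameSupport ηcen ηloc)
    (hκ0 : 0 ≤ κ) (hκ : ∀ u, M.dobrushin u ≤ κ) (k : Fin K) (i : ℕ) :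
    priorRisk M π N β ηcen ηloc P ξ a k (i + 1) ≤
      ENNReal.ofReal κ * postRisk M π N β ηcen ηloc P ξ a k i
        + ENNReal.ofReal (((K : ℝ) - N.minDeg) * τ) := by
  rw [h.priorRisk_eq hB hτ h0, h.postRisk_eq hB hτ h0, ← lintegral_const_mul' _ _
    ENNReal.ofReal_ne_top]
  have h1 : ENNReal.ofReal (((K : ℝ) - N.minDeg) * τ)
      = ∫⁻ _, ENNReal.ofReal (((K : ℝ) - N.minDeg) * τ) ∂P := by
    rw [lintegral_const, measure_univ, mul_one]
  rw [h1, ← lintegral_add_right _ measurable_const]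
  refine lintegral_mono_ae ?_
  filter_upwards [h.ae_lik_pos hB] with ω hω
  rw [← ENNReal.ofReal_mul hκ0]
  refine (ENNReal.ofReal_le_ofReal ?_).trans ENNReal.ofReal_add_le
  exact klSum_predict_le hτ (sameSupport_belief hτ h0 hω (fun j => a j ω) i) (hκ (a i ω)) k

/-- The risks approach their asymptotic bounds at the linear rate `κ`. -/
theorem risk_le (h : IsDiffusionProcess M π N β ηcen ηloc P s ξ a)
    (hB : M.BoundedLik B) (hτ : M.HopBound π N τ) (h0 : SameSupport ηcen ηloc)
    (hκ0 : 0 ≤ κ) (hκ : ∀ u, M.dobrushin u ≤ κ) (hκ1 : κ < 1) {R b c : ℝ}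
    (hY : 0 ≤ ((K : ℝ) - N.minDeg) * τ)
    (hR0 : 0 ≤ R) (hR : ∀ k, (∑ l, |1 - β * N.weight l k|) * B ≤ R)
    (hb : b * (1 - κ) = κ * (2 * R) + ((K : ℝ) - N.minDeg) * τ)
    (hc : ∀ k, klSum ηcen (ηloc k) ≤ c) (hc0 : 0 ≤ c) (i : ℕ) (k : Fin K) :
    postRisk M π N β ηcen ηloc P ξ a k i ≤ ENNReal.ofReal (b + 2 * R + c * κ ^ i) ∧
      priorRisk M π N β ηcen ηloc P ξ a k i ≤ ENNReal.ofReal (b + c * κ ^ i) := by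
  have hb0 : 0 ≤ b := by
    have : 0 ≤ b * (1 - κ) := by rw [hb]; positivity
    exact nonneg_of_mul_nonneg_left this (by linarith)
  have hv : ∀ i, 0 ≤ b + c * κ ^ i := fun i => by positivity
  have hpost : ∀ i, (∀ k, priorRisk M π N β ηcen ηloc P ξ a k i
        ≤ ENNReal.ofReal (b + c * κ ^ i)) →
      ∀ k, postRisk M π N β ηcen ηloc P ξ a k i ≤ ENNReal.ofReal (b + 2 * R + c * κ ^ i) := by
    intro i hi k
    calc postRisk M π N β ηcen ηloc P ξ a k i
        ≤ ∑ l, ENNReal.ofReal (N.weight l k) * priorRisk M π N β ηcen ηloc P ξ a l i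
          + ENNReal.ofReal (2 * R) := h.postRisk_le hB hτ h0 k (hR k) i
      _ ≤ ∑ l, ENNReal.ofReal (N.weight l k) * ENNReal.ofReal (b + c * κ ^ i)
          + ENNReal.ofReal (2 * R) := by
          gcongr with l
          exact hi l
      _ = ENNReal.ofReal (b + 2 * R + c * κ ^ i) := by
          rw [← Finset.sum_mul, ← ENNReal.ofReal_sum_of_nonneg fun l _ => N.weight_nonneg l k,
            N.weight_sum, ENNReal.ofReal_one, one_mul,
            ← ENNReal.ofReal_add (hv i) (by positivity)]
          congr 1
          ring
  have hprior : ∀ i k, priorRisk M π N β ηcen ηloc P ξ a k i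
      ≤ ENNReal.ofReal (b + c * κ ^ i) := by
    intro i
    induction i with
    | zero =>
      intro k
      rw [h.priorRisk_eq hB hτ h0]
      refine (lintegral_mono (g := fun _ => ENNReal.ofReal (b + c * κ ^ 0)) fun ω =>
        ENNReal.ofReal_le_ofReal ?_).trans ?_
      · rw [pow_zero, mul_one]
        exact (hc k).trans (le_add_of_nonneg_left hb0)
      · rw [lintegral_const, measure_univ, mul_one]
    | succ i ih =>
      intro k
      calc priorRisk M π N β ηcen ηloc P ξ a k (i + 1)
          ≤ ENNReal.ofReal κ * postRisk M π N β ηcen ηloc P ξ a k i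
            + ENNReal.ofReal (((K : ℝ) - N.minDeg) * τ) := h.priorRisk_succ_le hB hτ h0 hκ0 hκ k i
        _ ≤ ENNReal.ofReal κ * ENNReal.ofReal (b + 2 * R + c * κ ^ i)
            + ENNReal.ofReal (((K : ℝ) - N.minDeg) * τ) := by
            gcongr
            exact hpost i ih k
        -- `b` is the fixed point of x ↦ κ (x + 2R) + (K − d_min) τ, so the excess is simply
        -- multiplied by κ.
        _ = ENNReal.ofReal (b + c * κ ^ (i + 1)) := by
            rw [← ENNReal.ofReal_mul hκ0, ← ENNReal.ofReal_add (by positivity) hY]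
            congr 1
            rw [pow_succ]
            linarith
  exact ⟨hpost i (hprior i) k, hprior i k⟩

end IsDiffusionProcess

theorem limsup_le_of_le_add_geometric {f : ℕ → ℝ≥0∞} {b : ℝ≥0∞} {c : ℝ≥0}
    (hκ0 : 0 ≤ κ) (hκ1 : κ < 1) (h : ∀ i, f i ≤ b + c * ENNReal.ofReal (κ ^ i)) :
    limsup f atTop ≤ b := by
  have ht : Tendsto (fun i : ℕ => b + c * ENNReal.ofReal (κ ^ i)) atTop (𝓝 b) := by
    have h1 := (ENNReal.tendsto_ofReal (tendsto_pow_atTop_nhds_zero_of_lt_one hκ0 hκ1))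
    have h2 := (ENNReal.Tendsto.const_mul (a := (c : ℝ≥0∞)) h1 (Or.inr ENNReal.coe_ne_top))
    simpa using h2.const_add b
  exact (limsup_le_limsup (Eventually.of_forall h)).trans ht.limsup_eq.le

end RiskBounds

/-! ### The main theorem. -/

theorem theorem1 {K : ℕ} {S : Type*} {A O : Fin K → Type*} [Fintype S]
    [MeasurableSpace S] [MeasurableSingletonClass S]
    [∀ k, Fintype (A k)] [∀ k, MeasurableSpace (A k)] [∀ k, MeasurableSingletonClass (A k)]
    [∀ k, MeasurableSpace (O k)] {Ω : Type*} [MeasurableSpace Ω]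
    (P : Measure Ω) [IsProbabilityMeasure P]
    (M : DecPOMDP K S A O) (π : JointPolicy K S A) (N : Network K)
    (β : ℝ) (hβ : 0 < β)
    (ηcen : S → ℝ) (hηcen : ∀ x, 0 < ηcen x) (hηcen_sum : ∑ x, ηcen x = 1)
    (ηloc : Fin K → S → ℝ) (hηloc : ∀ k x, 0 < ηloc k x) (hηloc_sum : ∀ k, ∑ x, ηloc k x = 1)
    (B : ℝ) (hB : M.BoundedLik B)
    (κ : ℝ) (hκ : ∀ u, M.dobrushin u ≤ κ) (hκ_lt : κ < 1)
    (τ : ℝ) (hτ : M.HopBound π N τ)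
    (s : ℕ → Ω → S) (ξ : ℕ → Ω → ∀ k, O k) (a : ℕ → Ω → ∀ k, A k)
    (hproc : IsDiffusionProcess M π N β ηcen ηloc P s ξ a) :
    -- the centralized beliefs are the posteriors given the joint history
    (∀ i x,
      P⟦s i ⁻¹' {x} | sigmaBefore ξ (i + 1) ⊔ sigmaBefore a i⟧
        =ᵐ[P] fun ω => M.centralBelief ηcen (fun j => ξ j ω) (fun j => a j ω) i x) ∧
    (∀ i x,
      P⟦s i ⁻¹' {x} | sigmaBefore ξ i ⊔ sigmaBefore a i⟧
        =ᵐ[P] fun ω => M.centralPrior ηcen (fun j => ξ j ω) (fun j => a j ω) i x) ∧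
    -- asymptotic bounds on the risks
    (∀ k,
      limsup (fun i => postRisk M π N β ηcen ηloc P ξ a k i) atTop ≤
        ENNReal.ofReal (2 * √(K : ℝ) * β * N.lam β * B / (1 - κ) +
          ((K : ℝ) - N.minDeg) * τ / (1 - κ))) ∧
    (∀ k,
      limsup (fun i => priorRisk M π N β ηcen ηloc P ξ a k i) atTop ≤
        ENNReal.ofReal (2 * κ * √(K : ℝ) * β * N.lam β * B / (1 - κ) +
          ((K : ℝ) - N.minDeg) * τ / (1 - κ))) ∧
    -- the bounds are approached at the linear rate `κ`
    ∃ c : ℝ≥0, ∀ k i,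
      postRisk M π N β ηcen ηloc P ξ a k i ≤
        ENNReal.ofReal (2 * √(K : ℝ) * β * N.lam β * B / (1 - κ) +
          ((K : ℝ) - N.minDeg) * τ / (1 - κ)) + c * ENNReal.ofReal (κ ^ i) ∧
      priorRisk M π N β ηcen ηloc P ξ a k i ≤
        ENNReal.ofReal (2 * κ * √(K : ℝ) * β * N.lam β * B / (1 - κ) +
          ((K : ℝ) - N.minDeg) * τ / (1 - κ)) + c * ENNReal.ofReal (κ ^ i) := by
  have hprior := hproc.condProb_prior fun x => (hηcen x).le
  have hpost := fun i => hproc.condProb_belief (fun x => (hηcen x).le) i (hprior i)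
  have h0 : SameSupport ηcen ηloc :=
    { central := ⟨fun x => (hηcen x).le, hηcen_sum⟩
      local_mem := fun k => ⟨fun x => (hηloc k x).le, hηloc_sum k⟩
      eq_zero_iff := fun k x =>
        ⟨fun h => absurd h (hηloc k x).ne', fun h => absurd h (hηcen x).ne'⟩ }
  have hS : Nonempty S := (exists_pos_of_mem_stdSimplex h0.central).nonempty
  obtain ⟨ω⟩ : Nonempty Ω := nonempty_of_isProbabilityMeasure P
  obtain ⟨k₀, -⟩ := N.self_weight
  have hκ0 : 0 ≤ κ := (M.dobrushin_nonneg (a 0 ω)).trans (hκ _)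
  have hB0 : 0 ≤ B := hB.nonneg k₀
  have hlam : 0 ≤ N.lam β := le_max_of_le_right N.mixingRate_nonneg
  have hdeg : (0 : ℝ) ≤ (K : ℝ) - N.minDeg := by
    have h1 : N.minDeg ≤ K :=
      (N.minDeg_le k₀).trans ((Finset.card_le_univ _).trans_eq (Fintype.card_fin K))
    rw [sub_nonneg]
    exact_mod_cast h1
  have hY : 0 ≤ ((K : ℝ) - N.minDeg) * τ := mul_nonneg hdeg hτ.nonneg
  set R : ℝ := √(K : ℝ) * β * N.lam β * B with hR
  have hR0 : 0 ≤ R := by positivity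
  have hone : (1 : ℝ) - κ ≠ 0 := by linarith
  set b : ℝ := 2 * κ * √(K : ℝ) * β * N.lam β * B / (1 - κ) +
    ((K : ℝ) - N.minDeg) * τ / (1 - κ) with hb
  -- The two asymptotic bounds differ by exactly one update cost: 2κR/(1 − κ) + 2R = 2R/(1 − κ).
  have hbR : 2 * √(K : ℝ) * β * N.lam β * B / (1 - κ) +
      ((K : ℝ) - N.minDeg) * τ / (1 - κ) = b + 2 * R := by
    rw [hb, hR]
    field_simp
    ring
  have hb1 : b * (1 - κ) = κ * (2 * R) + ((K : ℝ) - N.minDeg) * τ := by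
    rw [hb, hR]
    field_simp
  have hb0 : 0 ≤ b := by
    have : 0 ≤ b * (1 - κ) := by rw [hb1]; positivity
    exact nonneg_of_mul_nonneg_left this (by linarith)
  have hkl : ∀ k, 0 ≤ klSum ηcen (ηloc k) := fun k =>
    klSum_nonneg h0.central.1 (h0.local_mem k).1
  have hc0 : 0 ≤ ∑ k, klSum ηcen (ηloc k) := Finset.sum_nonneg fun k _ => hkl k
  -- The initial divergences, summed so that one constant serves all agents.
  set c : ℝ≥0 := ⟨∑ k, klSum ηcen (ηloc k), hc0⟩ with hc
  have hrate := fun i k => hproc.risk_le hB hτ h0 hκ0 hκ hκ_lt hY hR0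
    (fun k => mul_le_mul_of_nonneg_right (N.sum_abs_one_sub_weight_le hβ k) hB0) hb1
    (fun k => Finset.single_le_sum (fun k _ => hkl k) (Finset.mem_univ k)) hc0 i k
  have hsplit : ∀ (r : ℝ) (i : ℕ), 0 ≤ r → ENNReal.ofReal (r + (∑ k, klSum ηcen (ηloc k)) * κ ^ i)
      = ENNReal.ofReal r + c * ENNReal.ofReal (κ ^ i) := by
    intro r i hr
    rw [ENNReal.ofReal_add hr (by positivity), ENNReal.ofReal_mul hc0,
      ENNReal.ofReal_eq_coe_nnreal hc0]
    rfl
  rw [hbR]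
  have hall : ∀ k i,
      postRisk M π N β ηcen ηloc P ξ a k i
        ≤ ENNReal.ofReal (b + 2 * R) + c * ENNReal.ofReal (κ ^ i) ∧
      priorRisk M π N β ηcen ηloc P ξ a k i
        ≤ ENNReal.ofReal b + c * ENNReal.ofReal (κ ^ i) := fun k i => by
    rw [← hsplit _ i (by positivity), ← hsplit _ i hb0]
    exact hrate i k
  exact ⟨hpost, hprior, fun k => limsup_le_of_le_add_geometric hκ0 hκ_lt fun i => (hall k i).1,
    fun k => limsup_le_of_le_add_geometric hκ0 hκ_lt fun i => (hall k i).2, c, hall⟩
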